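/- Let $d=2k+1\ge 11$ be an odd integer, let $|0\rangle,\dots,|d-1\rangle$ be the computational basis of $\mathbb{C}^d$, and write $|i\pm j\rangle=|i\rangle\pm|j\rangle$ (and similarly for longer signed sums). Let $\mathcal{S}_d\subset\mathbb{C}^d\otimes\mathbb{C}^d$ be the set of the following (unnormalised) product states: - $|i\rangle|0-i+(2k-i)-2k\rangle$ for $1\le i\le k-1$; - $|0-(k-1)\rangle|1-(2k-1)\rangle$, and $|0-(j-1)\rangle|j-(2k-j)\rangle$ for $2\le j\le k-1$; - $\big(\sum_{i=0}^{k-1}|i\rangle\big)\big(\sum_{i=0}^{2k}|i\rangle\big)$; - $|k+1\rangle|k-(k+1)+(k-3)-(k-2)\rangle$, and $|k+i\rangle|k-(k+i)+(k-i)-(k-1)\rangle$ for $2\le i\le k$; - $|k-2k\rangle|(k+1)-(k-2)\rangle$, $|k-(k+1)\rangle|(k+2)-(k-1)\rangle$, and $|k-(k+j-1)\rangle|(k+j)-(k-j)\rangle$ for $3\le j\le k$; - $\big(\sum_{i=k}^{2k}|i\rangle\big)\big(\sum_{i=0}^{2k}|i\rangle\big)$. Then $\mathcal{S}_d$ is an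 orthogonal set of product states which has genuine hidden nonlocality of type I. That is: 1. $\mathcal{S}_d$ is locally distinguishable: some protocol of local operations and classical communication (LOCC) with finitely many steps identifies every state of $\mathcal{S}_d$ with certainty. 2. $\mathcal{S}_d$ is locally irredundant: for all factorisations (up to local unitaries) of Alice's and of Bob's space $\mathbb{C}^d$ into tensor products of subsystems of dimension at least $2$ (a single factor being allowed), after discarding (tracing out) one or more of the subsystems of Alice and Bob the reduced states are no longer mutually orthogonal with respect to $\langle\rho,\sigma\rangle=\mathrm{Tr}(\rho^\dagger\sigma)$. 3. There is a local measurement that preserves the mutual orthogonality of $\mathcal{S}_d$ and such that, for each of its outcomes, the set of post-measurement states is locally indistinguishable (that is, not locally distinguishable) and has the same cardinality as $\mathcal{S}_d$. This measurement can be chosen to be performed by Bob alone. In particular, for every odd $d\ge 11$ there is an orthogonal set without entanglement in $\mathbb{C}^d\otimes\mathbb{C}^d$ with genuine hidden nonlocality of type I. -/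

import Mathlib

open scoped Kronecker

noncomputable section

/-- A (possibly unnormalised) pure state vector of the bipartite system `ℂ^m ⊗ ℂ^n`, given by its
coordinates in the computational basis. -/
abbrev BipartiteVec (m n : ℕ) : Type := Fin m × Fin n → ℂ

/-- An orthogonal set of states: nonzero vectors that are pairwise orthogonal. -/
def IsOrthogonalSet {m n : ℕ} (S : Set (BipartiteVec m n)) : Prop :=
  (∀ ψ ∈ S, ψ ≠ 0) ∧ ∀ ψ ∈ S, ∀ φ ∈ S, ψ ≠ φ → star ψ ⬝ᵥ φ = 0

/-- The product vector `|a⟩|b⟩`. -/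
def tensorVec {m n : ℕ} (a : Fin m → ℂ) (b : Fin n → ℂ) : BipartiteVec m n :=
  fun x => a x.1 * b x.2

/-- A product state, i.e. a state without entanglement. -/
def IsProductState {m n : ℕ} (ψ : BipartiteVec m n) : Prop :=
  ψ ≠ 0 ∧ ∃ (a : Fin m → ℂ) (b : Fin n → ℂ), ψ = tensorVec a b

/-! ### Local measurements and LOCC -/

/-- A quantum measurement with finitely many outcomes on `ℂ^n`, given by Kraus operators. The output
space may depend on the outcome, so that ancillas and classical randomness are covered. -/
structure Measurement (n : ℕ) where
  /-- number of outcomes -/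
  outcomes : ℕ
  /-- dimension of the system after each outcome -/
  dim : Fin outcomes → ℕ
  /-- the Kraus operator of each outcome -/
  op : (μ : Fin outcomes) → Matrix (Fin (dim μ)) (Fin n) ℂ
  /-- completeness -/
  complete : ∑ μ, (op μ).conjTranspose * op μ = 1

/-- The trivial measurement: one outcome, nothing is done. -/
def Measurement.trivial (n : ℕ) : Measurement n where
  outcomes := 1
  dim := fun _ => n
  op := fun _ => 1
  complete := by simp

/-- A finite LOCC protocol on `ℂ^m ⊗ ℂ^n`: in each step one party measures, and the outcome, which is
communicated to the other party, decides how the protocol goes on. At the end a label is announced. -/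
inductive LOCCProtocol (ι : Type) : ℕ → ℕ → Type
  | announce {m n : ℕ} (i : ι) : LOCCProtocol ι m n
  | alice {m n : ℕ} (M : Measurement m)
      (next : (μ : Fin M.outcomes) → LOCCProtocol ι (M.dim μ) n) : LOCCProtocol ι m n
  | bob {m n : ℕ} (M : Measurement n)
      (next : (μ : Fin M.outcomes) → LOCCProtocol ι m (M.dim μ)) : LOCCProtocol ι m n

open Classical in
/-- The probability that the protocol announces the label `i` on input `ψ`, multiplied by the squared
norm of `ψ` (the input may be unnormalised). -/
def LOCCProtocol.weight {ι : Type} :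
    {m n : ℕ} → LOCCProtocol ι m n → BipartiteVec m n → ι → ℝ
  | _, _, .announce j, ψ, i => if j = i then ∑ x, ‖ψ x‖ ^ 2 else 0
  | _, n, .alice M next, ψ, i =>
      ∑ μ, (next μ).weight ((M.op μ ⊗ₖ (1 : Matrix (Fin n) (Fin n) ℂ)).mulVec ψ) i
  | m, _, .bob M next, ψ, i =>
      ∑ μ, (next μ).weight (((1 : Matrix (Fin m) (Fin m) ℂ) ⊗ₖ M.op μ).mulVec ψ) i

/-- Local distinguishability: some LOCC protocol identifies every state of the set with
probability one. -/
def IsLocallyDistinguishable {m n : ℕ} (S : Set (BipartiteVec m n)) : Prop :=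
  ∃ P : LOCCProtocol (BipartiteVec m n) m n, ∀ ψ ∈ S, P.weight ψ ψ = ∑ x, ‖ψ x‖ ^ 2

/-! ### Local irredundancy -/

/-- A factorisation of `ℂ^d` into subsystems of dimensions at least two: a unitary
`ℂ^d → ⨂ i, ℂ^(dim i)`, the target being written in its product basis. -/
structure Factorisation (d : ℕ) where
  /-- number of subsystems -/
  parts : ℕ
  /-- dimensions of the subsystems -/
  dim : Fin parts → ℕ
  two_le_dim : ∀ i, 2 ≤ dim i
  /-- the identification -/
  U : Matrix ((i : Fin parts) → Fin (dim i)) (Fin d) ℂ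
  isometry : U.conjTranspose * U = 1
  coisometry : U * U.conjTranspose = 1

/-- Basis labels of the subsystems that are kept when those in `D` are discarded. -/
abbrev Factorisation.Kept {d : ℕ} (F : Factorisation d) (D : Finset (Fin F.parts)) : Type :=
  (i : {i : Fin F.parts // i ∉ D}) → Fin (F.dim i)

/-- Basis labels of the discarded subsystems. -/
abbrev Factorisation.Discarded {d : ℕ} (F : Factorisation d) (D : Finset (Fin F.parts)) : Type :=
  (i : {i : Fin F.parts // i ∈ D}) → Fin (F.dim i)

/-- The basis label of the whole system with given kept and discarded parts. -/
def Factorisation.merge {d : ℕ} (F : Factorisation d) (D : Finset (Fin F.parts))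
    (x : F.Kept D) (z : F.Discarded D) : (i : Fin F.parts) → Fin (F.dim i) :=
  fun i => if h : i ∈ D then z ⟨i, h⟩ else x ⟨i, h⟩

/-- The partial trace of an operator on `(⨂ i, ℂ^(F.dim i)) ⊗ (⨂ j, ℂ^(G.dim j))` over the subsystems
`DA` of the first party and `DB` of the second. -/
def partialTrace {m n : ℕ} (F : Factorisation m) (G : Factorisation n)
    (DA : Finset (Fin F.parts)) (DB : Finset (Fin G.parts))
    (ρ : Matrix (((i : Fin F.parts) → Fin (F.dim i)) × ((j : Fin G.parts) → Fin (G.dim j)))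
      (((i : Fin F.parts) → Fin (F.dim i)) × ((j : Fin G.parts) → Fin (G.dim j))) ℂ) :
    Matrix (F.Kept DA × G.Kept DB) (F.Kept DA × G.Kept DB) ℂ :=
  fun x y => ∑ z : F.Discarded DA, ∑ w : G.Discarded DB,
    ρ (F.merge DA x.1 z, G.merge DB x.2 w) (F.merge DA y.1 z, G.merge DB y.2 w)

/-- The reduced operator of `|ψ⟩⟨ψ|` after discarding the subsystems `DA` and `DB`. -/
def reducedState {m n : ℕ} (F : Factorisation m) (G : Factorisation n)
    (DA : Finset (Fin F.parts)) (DB : Finset (Fin G.parts)) (ψ : BipartiteVec m n) :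
    Matrix (F.Kept DA × G.Kept DB) (F.Kept DA × G.Kept DB) ℂ :=
  partialTrace F G DA DB
    (Matrix.vecMulVec ((F.U ⊗ₖ G.U).mulVec ψ) (star ((F.U ⊗ₖ G.U).mulVec ψ)))

/-- A set is locally redundant if for some factorisations of the two local systems it remains
orthogonal after discarding one or more subsystems. A whole party may be discarded too. -/
def IsLocallyRedundant {m n : ℕ} (S : Set (BipartiteVec m n)) : Prop :=
  ∃ (F : Factorisation m) (G : Factorisation n)
    (DA : Finset (Fin F.parts)) (DB : Finset (Fin G.parts)),
    (DA.Nonempty ∨ DB.Nonempty) ∧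
    ∀ ψ ∈ S, ∀ φ ∈ S, ψ ≠ φ →
      ((reducedState F G DA DB ψ).conjTranspose * reducedState F G DA DB φ).trace = 0

/-! ### Hidden nonlocality -/

/-- The states that can occur after the outcome `μ` of Alice's and `ν` of Bob's measurement
when the initial state was in `S`. -/
def postMeasurementSet {m n : ℕ} (A : Measurement m) (B : Measurement n)
    (μ : Fin A.outcomes) (ν : Fin B.outcomes) (S : Set (BipartiteVec m n)) :
    Set (BipartiteVec (A.dim μ) (B.dim ν)) :=
  {χ | χ ≠ 0 ∧ ∃ ψ ∈ S, (A.op μ ⊗ₖ B.op ν).mulVec ψ = χ}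

/-- The local measurement preserves the orthogonality of `S`, for every outcome. -/
def PreservesOrthogonality {m n : ℕ} (A : Measurement m) (B : Measurement n)
    (S : Set (BipartiteVec m n)) : Prop :=
  ∀ μ ν, ∀ ψ ∈ S, ∀ φ ∈ S, ψ ≠ φ →
    star ((A.op μ ⊗ₖ B.op ν).mulVec ψ) ⬝ᵥ (A.op μ ⊗ₖ B.op ν).mulVec φ = 0

/-- The local measurement preserves orthogonality, and for each outcome the set of post-measurement
states is locally indistinguishable and has as many elements as `S`. -/
def ActivatesNonlocality {m n : ℕ} (A : Measurement m) (B : Measurement n)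
    (S : Set (BipartiteVec m n)) : Prop :=
  PreservesOrthogonality A B S ∧
  ∀ μ ν, ¬ IsLocallyDistinguishable (postMeasurementSet A B μ ν S) ∧
    (postMeasurementSet A B μ ν S).encard = S.encard

/-- Genuine hidden nonlocality of type I. -/
def HasGenuineHiddenNonlocalityI {m n : ℕ} (S : Set (BipartiteVec m n)) : Prop :=
  IsLocallyDistinguishable S ∧ ¬ IsLocallyRedundant S ∧
  ∃ (A : Measurement m) (B : Measurement n), ActivatesNonlocality A B S

/-! ### The set of states -/

/-- The basis vector `|i⟩` of `ℂ^d`. -/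
def ket (d i : ℕ) : Fin d → ℂ := fun x => if (x : ℕ) = i then 1 else 0

/-- The vector `|a⟩ + |a+1⟩ + ⋯ + |b⟩` of `ℂ^d`. -/
def ketSum (d a b : ℕ) : Fin d → ℂ := ∑ i ∈ Finset.Icc a b, ket d i

/-- Alice's upper half of the construction in `ℂ^d ⊗ ℂ^d`, `d = 2k+1`: the states
`|ψ₁⟩, …, |ψ_{2k-1}⟩`. -/
def psiStates (d k : ℕ) : Set (BipartiteVec d d) :=
  {χ | ∃ i, 1 ≤ i ∧ i ≤ k - 1 ∧
    χ = tensorVec (ket d i) (ket d 0 - ket d i + ket d (2 * k - i) - ket d (2 * k))} ∪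
  {tensorVec (ket d 0 - ket d (k - 1)) (ket d 1 - ket d (2 * k - 1))} ∪
  {χ | ∃ j, 2 ≤ j ∧ j ≤ k - 1 ∧
    χ = tensorVec (ket d 0 - ket d (j - 1)) (ket d j - ket d (2 * k - j))} ∪
  {tensorVec (ketSum d 0 (k - 1)) (ketSum d 0 (2 * k))}

/-- Alice's lower half of the construction in `ℂ^d ⊗ ℂ^d`, `d = 2k+1`: the states
`|φ₁⟩, …, |φ_{2k+1}⟩`. -/
def phiStates (d k : ℕ) : Set (BipartiteVec d d) :=
  {tensorVec (ket d (k + 1)) (ket d k - ket d (k + 1) + ket d (k - 3) - ket d (k - 2))} ∪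
  {χ | ∃ i, 2 ≤ i ∧ i ≤ k ∧
    χ = tensorVec (ket d (k + i)) (ket d k - ket d (k + i) + ket d (k - i) - ket d (k - 1))} ∪
  {tensorVec (ket d k - ket d (2 * k)) (ket d (k + 1) - ket d (k - 2)),
    tensorVec (ket d k - ket d (k + 1)) (ket d (k + 2) - ket d (k - 1))} ∪
  {χ | ∃ j, 3 ≤ j ∧ j ≤ k ∧
    χ = tensorVec (ket d k - ket d (k + j - 1)) (ket d (k + j) - ket d (k - j))} ∪
  {tensorVec (ketSum d k (2 * k)) (ketSum d 0 (2 * k))}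

/-- The set of product states in `ℂ^d ⊗ ℂ^d` for odd `d`. -/
def hiddenNonlocalSet (d : ℕ) : Set (BipartiteVec d d) :=
  psiStates d ((d - 1) / 2) ∪ phiStates d ((d - 1) / 2)

end

/-! Write d = 2k + 1, so that k ≥ 5. Alice's factors fall into two families, supported on the levels
0, …, k − 1 and k, …, 2k. The activating measurement is Bob's: he asks which of these two ranges his
own system is in (`windowMeasurement`). The low outcome cuts the tails off Bob's factors in the
upper family, the high outcome those in the lower family. What is left, up to a shift of levels, is
`StablePair`: squares |i⟩|0 − i⟩, edges |0 − x⟩|j⟩ and a stopper with all coordinates one.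

For such a set every orthogonality-preserving local operator is a multiple of the identity
(`StablePair.alice`, `StablePair.bob`). A protocol that identifies states with certainty must keep
them orthogonal at every node (`LOCCProtocol.Identifies.orthogonal`). Along a suitable branch the
accumulated local operators therefore stay proportional to isometries, and the leaf at its end
announces one label for different states (`LOCCProtocol.not_forall_identifies`). The tails are
designed so that orthogonality holds in each range separately (`StatePair.orthogonal`) and no state
is annihilated (`StatePair.window_mulVec_ne_zero`). Hence the measurement is legitimate and keeps
the number of states.

The unmeasured set is distinguishable because the tails also help Bob. Alice measures her range, Bob
projects onto an orthogonal frame adapted to it (`upperFrame`, `lowerFrame`) or onto its complement,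
and Alice reads off her level. Each sequence of outcomes is compatible with one state only
(`UpperPair.eq_of_overlap`, `LowerPair.eq_of_overlap` and the two `eq_of_mulVec_ne_zero` lemmas).

Irredundancy is a dimension count. A discarded factor of an odd dimension is at least
three-dimensional, so at most d/3 dimensions remain for that party. Among the lower states there are
k − 1 whose factors would have to stay orthogonal there, because the other party's factors overlap,
and 3(k − 1) > 2k + 1 (`Factorisation.three_mul_card_le`). -/

/-! ### Norms, inner products and completeness of measurements -/

theorem star_dotProduct_self {ι : Type*} [Fintype ι] (ψ : ι → ℂ) :
    star ψ ⬝ᵥ ψ = ((∑ x, ‖ψ x‖ ^ 2 : ℝ) : ℂ) := by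
  simp [dotProduct, Complex.conj_mul']

theorem eq_zero_of_star_dotProduct_self {ι : Type*} [Fintype ι] {ψ : ι → ℂ}
    (h : star ψ ⬝ᵥ ψ = 0) : ψ = 0 := by
  rw [star_dotProduct_self, Complex.ofReal_eq_zero,
    Finset.sum_eq_zero_iff_of_nonneg (fun _ _ => by positivity)] at h
  ext x
  simpa using h x (Finset.mem_univ x)

theorem star_mulVec_dotProduct_mulVec {ι κ : Type*} [Fintype ι] [Fintype κ]
    (K : Matrix κ ι ℂ) (ψ φ : ι → ℂ) :
    star (K.mulVec ψ) ⬝ᵥ K.mulVec φ = star ψ ⬝ᵥ (K.conjTranspose * K).mulVec φ := by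
  rw [Matrix.star_mulVec, ← Matrix.dotProduct_mulVec, Matrix.mulVec_mulVec]

theorem sum_star_mulVec_dotProduct {ι : Type*} [Fintype ι] [DecidableEq ι] {N : ℕ}
    {κ : Fin N → Type} [∀ μ, Fintype (κ μ)] (K : (μ : Fin N) → Matrix (κ μ) ι ℂ)
    (hK : ∑ μ, (K μ).conjTranspose * K μ = 1) (ψ φ : ι → ℂ) :
    ∑ μ, star ((K μ).mulVec ψ) ⬝ᵥ (K μ).mulVec φ = star ψ ⬝ᵥ φ := by
  simp_rw [star_mulVec_dotProduct_mulVec]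
  rw [← dotProduct_sum, ← Matrix.sum_mulVec, hK, Matrix.one_mulVec]

theorem sum_sqNorm_mulVec {ι : Type*} [Fintype ι] [DecidableEq ι] {N : ℕ}
    {κ : Fin N → Type} [∀ μ, Fintype (κ μ)] (K : (μ : Fin N) → Matrix (κ μ) ι ℂ)
    (hK : ∑ μ, (K μ).conjTranspose * K μ = 1) (ψ : ι → ℂ) :
    ∑ μ, ∑ x, ‖(K μ).mulVec ψ x‖ ^ 2 = ∑ x, ‖ψ x‖ ^ 2 := by
  have h := sum_star_mulVec_dotProduct K hK ψ ψ
  simp only [star_dotProduct_self] at h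
  exact_mod_cast h

theorem Measurement.complete_kronecker_one {m : ℕ} (M : Measurement m) (n : ℕ) :
    ∑ μ, (M.op μ ⊗ₖ (1 : Matrix (Fin n) (Fin n) ℂ)).conjTranspose *
      (M.op μ ⊗ₖ (1 : Matrix (Fin n) (Fin n) ℂ)) = 1 := by
  simp_rw [Matrix.conjTranspose_kronecker, ← Matrix.mul_kronecker_mul, Matrix.conjTranspose_one,
    Matrix.one_mul]
  rw [← Matrix.one_kronecker_one, ← M.complete]
  ext x y
  simp [Matrix.sum_apply, Finset.sum_mul]

theorem Measurement.complete_one_kronecker {n : ℕ} (M : Measurement n) (m : ℕ) :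
    ∑ μ, ((1 : Matrix (Fin m) (Fin m) ℂ) ⊗ₖ M.op μ).conjTranspose *
      ((1 : Matrix (Fin m) (Fin m) ℂ) ⊗ₖ M.op μ) = 1 := by
  simp_rw [Matrix.conjTranspose_kronecker, ← Matrix.mul_kronecker_mul, Matrix.conjTranspose_one,
    Matrix.one_mul]
  rw [← Matrix.one_kronecker_one, ← M.complete]
  ext x y
  simp [Matrix.sum_apply, Finset.mul_sum]

theorem LOCCProtocol.weight_le {L : Type} {m n : ℕ} (P : LOCCProtocol L m n)
    (ψ : BipartiteVec m n) (i : L) : P.weight ψ i ≤ ∑ x, ‖ψ x‖ ^ 2 := by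
  induction P with
  | announce j =>
    simp only [LOCCProtocol.weight]
    split_ifs
    · exact le_rfl
    · positivity
  | alice M next ih =>
    simp only [LOCCProtocol.weight]
    rw [← sum_sqNorm_mulVec _ (M.complete_kronecker_one _) ψ]
    exact Finset.sum_le_sum fun μ _ => ih μ _
  | bob M next ih =>
    simp only [LOCCProtocol.weight]
    rw [← sum_sqNorm_mulVec _ (M.complete_one_kronecker _) ψ]
    exact Finset.sum_le_sum fun μ _ => ih μ _

/-! ### Identification with certainty along an LOCC protocol -/

/-- The protocol announces the label `i` with certainty on input `ψ`. -/
def LOCCProtocol.Identifies {L : Type} {m n : ℕ} (P : LOCCProtocol L m n)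
    (ψ : BipartiteVec m n) (i : L) : Prop :=
  P.weight ψ i = ∑ x, ‖ψ x‖ ^ 2

theorem LOCCProtocol.identifies_announce_iff {L : Type} {m n : ℕ} (j i : L)
    (ψ : BipartiteVec m n) :
    (LOCCProtocol.announce j : LOCCProtocol L m n).Identifies ψ i ↔ (ψ ≠ 0 → j = i) := by
  unfold LOCCProtocol.Identifies
  simp only [LOCCProtocol.weight]
  split_ifs with h
  · simp [h]
  · simp only [h, imp_false, not_not]
    rw [eq_comm, Finset.sum_eq_zero_iff_of_nonneg (fun _ _ => by positivity)]
    simp [funext_iff]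

/-- By completeness the squared norms of the branches add up to that of the input. No branch weight
exceeds its squared norm, so equality of the totals forces equality in every branch. -/
theorem LOCCProtocol.identifies_alice_iff {L : Type} {m n : ℕ} (M : Measurement m)
    (next : (μ : Fin M.outcomes) → LOCCProtocol L (M.dim μ) n) (ψ : BipartiteVec m n) (i : L) :
    (LOCCProtocol.alice M next).Identifies ψ i ↔
      ∀ μ, (next μ).Identifies
        ((M.op μ ⊗ₖ (1 : Matrix (Fin n) (Fin n) ℂ)).mulVec ψ) i := by
  unfold LOCCProtocol.Identifies
  simp only [LOCCProtocol.weight]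
  rw [← sum_sqNorm_mulVec _ (M.complete_kronecker_one _) ψ,
    Finset.sum_eq_sum_iff_of_le (fun μ _ => LOCCProtocol.weight_le _ _ _)]
  simp

theorem LOCCProtocol.identifies_bob_iff {L : Type} {m n : ℕ} (M : Measurement n)
    (next : (μ : Fin M.outcomes) → LOCCProtocol L m (M.dim μ)) (ψ : BipartiteVec m n) (i : L) :
    (LOCCProtocol.bob M next).Identifies ψ i ↔
      ∀ μ, (next μ).Identifies
        (((1 : Matrix (Fin m) (Fin m) ℂ) ⊗ₖ M.op μ).mulVec ψ) i := by
  unfold LOCCProtocol.Identifies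
  simp only [LOCCProtocol.weight]
  rw [← sum_sqNorm_mulVec _ (M.complete_one_kronecker _) ψ,
    Finset.sum_eq_sum_iff_of_le (fun μ _ => LOCCProtocol.weight_le _ _ _)]
  simp

/-- A leaf announces a single label, so one of the two vectors reaching it is zero. Completeness
writes the inner product at a node as the sum of those over its branches, which carries
orthogonality back to the root. -/
theorem LOCCProtocol.Identifies.orthogonal {L : Type} {m n : ℕ} {P : LOCCProtocol L m n}
    {ψ φ : BipartiteVec m n} {i j : L} (hψ : P.Identifies ψ i) (hφ : P.Identifies φ j)
    (hij : i ≠ j) : star ψ ⬝ᵥ φ = 0 := by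
  induction P with
  | announce l =>
    rw [LOCCProtocol.identifies_announce_iff] at hψ hφ
    by_cases h : ψ = 0
    · simp [h]
    · by_cases h' : φ = 0
      · simp [h']
      · exact absurd ((hψ h).symm.trans (hφ h')) hij
  | alice M next ih =>
    rw [LOCCProtocol.identifies_alice_iff] at hψ hφ
    rw [← sum_star_mulVec_dotProduct _ (M.complete_kronecker_one _)]
    exact Finset.sum_eq_zero fun μ _ => ih μ (hψ μ) (hφ μ)
  | bob M next ih =>
    rw [LOCCProtocol.identifies_bob_iff] at hψ hφ
    rw [← sum_star_mulVec_dotProduct _ (M.complete_one_kronecker _)]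
    exact Finset.sum_eq_zero fun μ _ => ih μ (hψ μ) (hφ μ)

/-! ### Product vectors, and indistinguishability from stability -/

theorem kronecker_mulVec_tensorVec {m n m' n' : ℕ} (A : Matrix (Fin m') (Fin m) ℂ)
    (B : Matrix (Fin n') (Fin n) ℂ) (a : Fin m → ℂ) (b : Fin n → ℂ) :
    (A ⊗ₖ B).mulVec (tensorVec a b) = tensorVec (A.mulVec a) (B.mulVec b) := by
  ext x
  simp only [Matrix.mulVec, dotProduct, tensorVec, Matrix.kroneckerMap_apply,
    Fintype.sum_prod_type, Finset.sum_mul_sum]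
  exact Finset.sum_congr rfl fun _ _ => Finset.sum_congr rfl fun _ _ => by ring

theorem star_tensorVec_dotProduct {m n : ℕ} (a a' : Fin m → ℂ) (b b' : Fin n → ℂ) :
    star (tensorVec a b) ⬝ᵥ tensorVec a' b' = (star a ⬝ᵥ a') * (star b ⬝ᵥ b') := by
  simp only [dotProduct, tensorVec, Fintype.sum_prod_type, Finset.sum_mul_sum, Pi.star_apply,
    star_mul']
  exact Finset.sum_congr rfl fun _ _ => Finset.sum_congr rfl fun _ _ => by ring

theorem tensorVec_ne_zero {m n : ℕ} {a : Fin m → ℂ} {b : Fin n → ℂ} (ha : a ≠ 0) (hb : b ≠ 0) :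
    tensorVec a b ≠ 0 := by
  obtain ⟨i, hi⟩ := Function.ne_iff.mp ha
  obtain ⟨j, hj⟩ := Function.ne_iff.mp hb
  exact fun h => mul_ne_zero hi hj (congrFun h (i, j))

/-- Every local operation of the first party that preserves the orthogonality of the product
vectors in `T` is trivial. -/
def AliceStable {p q : ℕ} (T : (Fin p → ℂ) → (Fin q → ℂ) → Prop) : Prop :=
  ∀ E : Matrix (Fin p) (Fin p) ℂ,
    (∀ a b a' b', T a b → T a' b' → star a ⬝ᵥ a' = 0 → star b ⬝ᵥ b' ≠ 0 →
      star a ⬝ᵥ E.mulVec a' = 0) → ∃ c : ℂ, E = c • 1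

/-- The stability of `AliceStable` for the second party. -/
def BobStable {p q : ℕ} (T : (Fin p → ℂ) → (Fin q → ℂ) → Prop) : Prop :=
  ∀ E : Matrix (Fin q) (Fin q) ℂ,
    (∀ a b a' b', T a b → T a' b' → star b ⬝ᵥ b' = 0 → star a ⬝ᵥ a' ≠ 0 →
      star b ⬝ᵥ E.mulVec b' = 0) → ∃ c : ℂ, E = c • 1

/-- The sandwiches of all outcomes add up to `Xᴴ * X`, so they cannot all vanish. This selects the
branch to follow below. -/
theorem Measurement.exists_sandwich_ne_zero {m p : ℕ} (M : Measurement m)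
    (X : Matrix (Fin m) (Fin p) ℂ) (hX : X.conjTranspose * X ≠ 0) :
    ∃ μ, (M.op μ * X).conjTranspose * (M.op μ * X) ≠ 0 := by
  by_contra! h
  apply hX
  calc X.conjTranspose * X = X.conjTranspose * (∑ μ, (M.op μ).conjTranspose * M.op μ) * X := by
        rw [M.complete, Matrix.mul_one]
    _ = ∑ μ, (M.op μ * X).conjTranspose * (M.op μ * X) := by
        rw [Matrix.mul_sum, Matrix.sum_mul]
        simp only [Matrix.conjTranspose_mul, Matrix.mul_assoc]
    _ = 0 := Finset.sum_eq_zero fun μ _ => h μ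

/-- The induction follows one branch with the invariant that the accumulated operators `X` and `Y`
are nonzero multiples of isometries. After a measurement by one party, the identified states are
still orthogonal. Where the other party's factors overlap, that overlap has only been rescaled, so
the new sandwich satisfies the hypothesis of stability and is scalar. The labels go through the
injective `lab` because they refer to the initial space, while the current dimensions change along
the branch. -/
theorem LOCCProtocol.not_forall_identifies {L : Type} {p q m n : ℕ}
    {T : (Fin p → ℂ) → (Fin q → ℂ) → Prop}
    (hT : ∀ a b, T a b → a ≠ 0 ∧ b ≠ 0)
    (hpair : ∃ a b a' b', T a b ∧ T a' b' ∧ star a ⬝ᵥ a' = 0)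
    (hA : AliceStable T) (hB : BobStable T)
    (lab : BipartiteVec p q → L) (hlab : Function.Injective lab)
    (P : LOCCProtocol L m n) (X : Matrix (Fin m) (Fin p) ℂ) (Y : Matrix (Fin n) (Fin q) ℂ)
    {c c' : ℂ} (hc : c ≠ 0) (hc' : c' ≠ 0)
    (hX : X.conjTranspose * X = c • 1) (hY : Y.conjTranspose * Y = c' • 1) :
    ¬ ∀ a b, T a b → P.Identifies (tensorVec (X.mulVec a) (Y.mulVec b)) (lab (tensorVec a b)) := by
  have hdist : ∀ {a b a' b'}, T a b → T a' b' → (star a ⬝ᵥ a') * (star b ⬝ᵥ b') = 0 →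
      lab (tensorVec a b) ≠ lab (tensorVec a' b') := by
    intro a b a' b' h h' h0 heq
    have h1 := hlab heq
    have h2 := star_tensorVec_dotProduct a a' b b'
    rw [h0, ← h1] at h2
    exact tensorVec_ne_zero (hT _ _ h).1 (hT _ _ h).2 (eq_zero_of_star_dotProduct_self h2)
  have hinj : ∀ {r s : ℕ} (Z : Matrix (Fin r) (Fin s) ℂ) (e : ℂ), e ≠ 0 →
      Z.conjTranspose * Z = e • 1 → ∀ v, v ≠ 0 → Z.mulVec v ≠ 0 := by
    intro r s Z e he hZ v hv h0
    have h1 := congrArg Z.conjTranspose.mulVec h0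
    rw [Matrix.mulVec_mulVec, hZ, Matrix.smul_mulVec, Matrix.one_mulVec, Matrix.mulVec_zero] at h1
    exact (smul_ne_zero he hv) h1
  have hne : ∀ {s : ℕ} (v : Fin s → ℂ) (e : ℂ), v ≠ 0 → e ≠ 0 →
      (e • 1 : Matrix (Fin s) (Fin s) ℂ) ≠ 0 := by
    intro s v e hv he h0
    have h1 := congrArg (fun Z => Z.mulVec v) h0
    simp only [Matrix.smul_mulVec, Matrix.one_mulVec, Matrix.zero_mulVec] at h1
    exact (smul_ne_zero he hv) h1
  obtain ⟨a₀, b₀, a₁, b₁, h₀, h₁, h₀₁⟩ := hpair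
  induction P generalizing c c' with
  -- Neither of the two orthogonal states of the pair has been annihilated, so the leaf would have
  -- to give both of their distinct labels.
  | announce l =>
    intro h
    have e0 := (LOCCProtocol.identifies_announce_iff _ _ _).1 (h _ _ h₀)
      (tensorVec_ne_zero (hinj X c hc hX _ (hT _ _ h₀).1) (hinj Y c' hc' hY _ (hT _ _ h₀).2))
    have e1 := (LOCCProtocol.identifies_announce_iff _ _ _).1 (h _ _ h₁)
      (tensorVec_ne_zero (hinj X c hc hX _ (hT _ _ h₁).1) (hinj Y c' hc' hY _ (hT _ _ h₁).2))
    exact hdist h₀ h₁ (by simp [h₀₁]) (e0.symm.trans e1)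
  | alice M next ih =>
    intro h
    obtain ⟨μ, hμ⟩ := M.exists_sandwich_ne_zero X
      (by rw [hX]; exact hne a₀ c (hT _ _ h₀).1 hc)
    have key : ∀ a b, T a b → (next μ).Identifies
        (tensorVec ((M.op μ * X).mulVec a) (Y.mulVec b)) (lab (tensorVec a b)) := by
      intro a b hab
      have := (LOCCProtocol.identifies_alice_iff _ _ _ _).1 (h a b hab) μ
      rwa [kronecker_mulVec_tensorVec, Matrix.one_mulVec, Matrix.mulVec_mulVec] at this
    obtain ⟨e, he⟩ := hA ((M.op μ * X).conjTranspose * (M.op μ * X)) (by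
      intro a b a' b' hab hab' h0 h1
      have := (key _ _ hab).orthogonal (key _ _ hab') (hdist hab hab' (by simp [h0]))
      rw [star_tensorVec_dotProduct, star_mulVec_dotProduct_mulVec, star_mulVec_dotProduct_mulVec,
        hY, Matrix.smul_mulVec, Matrix.one_mulVec, dotProduct_smul] at this
      simpa [hc', h1] using this)
    exact ih μ _ Y (c := e) (by rintro rfl; exact hμ (he.trans (zero_smul _ _))) hc' he hY key
  | bob M next ih =>
    intro h
    obtain ⟨μ, hμ⟩ := M.exists_sandwich_ne_zero Y
      (by rw [hY]; exact hne b₀ c' (hT _ _ h₀).2 hc')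
    have key : ∀ a b, T a b → (next μ).Identifies
        (tensorVec (X.mulVec a) ((M.op μ * Y).mulVec b)) (lab (tensorVec a b)) := by
      intro a b hab
      have := (LOCCProtocol.identifies_bob_iff _ _ _ _).1 (h a b hab) μ
      rwa [kronecker_mulVec_tensorVec, Matrix.one_mulVec, Matrix.mulVec_mulVec] at this
    obtain ⟨e, he⟩ := hB ((M.op μ * Y).conjTranspose * (M.op μ * Y)) (by
      intro a b a' b' hab hab' h0 h1
      have := (key _ _ hab).orthogonal (key _ _ hab') (hdist hab hab' (by simp [h0]))
      rw [star_tensorVec_dotProduct, star_mulVec_dotProduct_mulVec, star_mulVec_dotProduct_mulVec,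
        hX, Matrix.smul_mulVec, Matrix.one_mulVec, dotProduct_smul] at this
      simpa [hc, h1] using this)
    exact ih μ X _ (c' := e) hc (by rintro rfl; exact hμ (he.trans (zero_smul _ _))) hX he key

/-- A set that contains a locally isometric image of a stable set of product vectors is not
locally distinguishable. -/
theorem not_isLocallyDistinguishable_of_stable {p q m n : ℕ}
    {T : (Fin p → ℂ) → (Fin q → ℂ) → Prop}
    (hT : ∀ a b, T a b → a ≠ 0 ∧ b ≠ 0)
    (hpair : ∃ a b a' b', T a b ∧ T a' b' ∧ star a ⬝ᵥ a' = 0)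
    (hA : AliceStable T) (hB : BobStable T) {S : Set (BipartiteVec m n)}
    (X : Matrix (Fin m) (Fin p) ℂ) (Y : Matrix (Fin n) (Fin q) ℂ)
    (hX : X.conjTranspose * X = 1) (hY : Y.conjTranspose * Y = 1)
    (hS : ∀ a b, T a b → tensorVec (X.mulVec a) (Y.mulVec b) ∈ S) :
    ¬ IsLocallyDistinguishable S := by
  rintro ⟨P, hP⟩
  -- The label of a pair is the corresponding element of `S`; it is injective since the isometries
  -- have their adjoints as left inverses.
  refine P.not_forall_identifies hT hpair hA hB (fun ψ => (X ⊗ₖ Y).mulVec ψ) ?_ X Y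
    one_ne_zero one_ne_zero (by simpa using hX) (by simpa using hY) ?_
  · refine Function.LeftInverse.injective
      (g := fun ψ => (X.conjTranspose ⊗ₖ Y.conjTranspose).mulVec ψ) fun ψ => ?_
    dsimp only
    rw [Matrix.mulVec_mulVec, ← Matrix.mul_kronecker_mul, hX, hY, Matrix.one_kronecker_one,
      Matrix.one_mulVec]
  · intro a b hab
    have := hP _ (hS a b hab)
    simpa only [LOCCProtocol.Identifies, kronecker_mulVec_tensorVec] using this

/-! ### Three-round protocols and projective measurements -/

/-- The measurement in the computational basis; the system is discarded. -/
def Measurement.computational (n : ℕ) : Measurement n where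
  outcomes := n
  dim := fun _ => 1
  op := fun μ => Matrix.of fun _ j => if j = μ then 1 else 0
  complete := by
    ext x y
    simp [Matrix.sum_apply, Matrix.mul_apply, Matrix.one_apply, eq_comm]

theorem Measurement.computational_op_mulVec {n : ℕ}
    (μ : Fin (Measurement.computational n).outcomes) (a : Fin n → ℂ) :
    ((Measurement.computational n).op μ).mulVec a = fun _ => a (show Fin n from μ) := by
  ext x
  change ∑ j, (if j = (show Fin n from μ) then (1 : ℂ) else 0) * a j = a μ
  rw [Finset.sum_eq_single (show Fin n from μ)]
  · exact (congrArg (· * a μ) (if_pos rfl)).trans (one_mul _)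
  · intro j _ hj
    rw [if_neg hj, zero_mul]
  · exact fun h => absurd (Finset.mem_univ _) h

theorem tensorVec_zero_left {m n : ℕ} (b : Fin n → ℂ) :
    tensorVec (0 : Fin m → ℂ) b = 0 := by
  ext x; simp [tensorVec]

theorem tensorVec_zero_right {m n : ℕ} (a : Fin m → ℂ) :
    tensorVec a (0 : Fin n → ℂ) = 0 := by
  ext x; simp [tensorVec]

/-- Product states are identified by a measurement of the first party, a measurement of the second
one that depends on the outcome, and a final measurement of the first party in the
computational basis, provided that each sequence of outcomes is possible for one state only. -/
theorem isLocallyDistinguishable_of_measurements {m n : ℕ}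
    (T : (Fin m → ℂ) → (Fin n → ℂ) → Prop) (A : Measurement m)
    (h : ∀ μ, ∃ N : Measurement n, ∀ ν x a b a' b', T a b → T a' b' →
      (A.op μ).mulVec a x ≠ 0 → (A.op μ).mulVec a' x ≠ 0 →
      (N.op ν).mulVec b ≠ 0 → (N.op ν).mulVec b' ≠ 0 → tensorVec a b = tensorVec a' b') :
    IsLocallyDistinguishable {χ | ∃ a b, T a b ∧ χ = tensorVec a b} := by
  choose N h using h
  have hlab : ∀ μ ν x, ∃ l : BipartiteVec m n, ∀ a b, T a b → (A.op μ).mulVec a x ≠ 0 →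
      ((N μ).op ν).mulVec b ≠ 0 → l = tensorVec a b := by
    intro μ ν x
    by_cases hex : ∃ a b, T a b ∧ (A.op μ).mulVec a x ≠ 0 ∧ ((N μ).op ν).mulVec b ≠ 0
    · obtain ⟨a, b, hab, hax, hb⟩ := hex
      exact ⟨tensorVec a b, fun a' b' hab' hax' hb' =>
        h μ ν x a b a' b' hab hab' hax hax' hb hb'⟩
    · push Not at hex
      -- A sequence of outcomes that no state reaches may get any label, here 0.
      exact ⟨0, fun a b hab hax hb => absurd (hex a b hab hax) hb⟩
  choose l hl using hlab
  refine ⟨.alice A fun μ => .bob (N μ) fun ν =>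
    .alice (Measurement.computational _) fun x => .announce (l μ ν x), ?_⟩
  rintro _ ⟨a, b, hab, rfl⟩
  change LOCCProtocol.Identifies _ _ _
  rw [LOCCProtocol.identifies_alice_iff]
  intro μ
  rw [LOCCProtocol.identifies_bob_iff]
  intro ν
  rw [LOCCProtocol.identifies_alice_iff]
  intro x
  rw [LOCCProtocol.identifies_announce_iff]
  simp only [kronecker_mulVec_tensorVec, Matrix.one_mulVec]
  intro hne
  refine hl μ ν x a b hab (fun h0 => hne ?_) (fun h0 => hne ?_)
  · have : ((Measurement.computational (A.dim μ)).op x).mulVec ((A.op μ).mulVec a) = 0 := by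
      rw [Measurement.computational_op_mulVec]
      ext; exact h0
    rw [this]
    exact tensorVec_zero_left _
  · rw [h0]
    exact tensorVec_zero_right _

/-- The projective measurement onto the lines spanned by pairwise orthogonal vectors and onto the
orthogonal complement of their span. -/
theorem exists_measurement_of_orthogonal {N n : ℕ} (e : Fin N → Fin n → ℂ)
    (hne : ∀ t, e t ≠ 0) (horth : ∀ s t, s ≠ t → star (e s) ⬝ᵥ e t = 0) :
    ∃ M : Measurement n, ∀ ν,
      (∃ t, ∀ b, star (e t) ⬝ᵥ b = 0 → (M.op ν).mulVec b = 0) ∨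
        ∀ t, (M.op ν).mulVec (e t) = 0 := by
  set c : Fin N → ℝ := fun t => ∑ x, ‖e t x‖ ^ 2 with hc
  have hcc : ∀ t, star (e t) ⬝ᵥ e t = (c t : ℂ) := fun t => star_dotProduct_self _
  have hc0 : ∀ t, (c t : ℂ) ≠ 0 := fun t h0 =>
    hne t (eq_zero_of_star_dotProduct_self ((hcc t).trans h0))
  set Q : Fin N → Matrix (Fin n) (Fin n) ℂ := fun t =>
    (c t : ℂ)⁻¹ • Matrix.vecMulVec (e t) (star (e t)) with hQ
  have hherm : ∀ t, (Q t).conjTranspose = Q t := by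
    intro t
    simp [hQ, Matrix.conjTranspose_smul, Matrix.conjTranspose_vecMulVec]
  have hmul : ∀ s t, Q s * Q t = if s = t then Q s else 0 := by
    intro s t
    simp only [hQ, Matrix.smul_mul, Matrix.mul_smul, Matrix.vecMulVec_mul_vecMulVec]
    split_ifs with hst
    · subst hst
      rw [hcc, Matrix.vecMulVec_smul, smul_smul, smul_smul, mul_assoc,
        inv_mul_cancel₀ (hc0 _), mul_one]
    · rw [horth s t hst, zero_smul, Matrix.vecMulVec_zero, smul_zero, smul_zero]
  have hsum : (∑ t, Q t) * (∑ t, Q t) = ∑ t, Q t := by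
    simp [Finset.sum_mul_sum, hmul]
  have hsumh : (∑ t, Q t).conjTranspose = ∑ t, Q t := by
    simp [Matrix.conjTranspose_sum, hherm]
  have hvec : ∀ t b, (Q t).mulVec b = ((c t : ℂ)⁻¹ * (star (e t) ⬝ᵥ b)) • e t := by
    intro t b
    simp only [hQ, Matrix.smul_mulVec, Matrix.vecMulVec_mulVec, op_smul_eq_smul, smul_smul]
  -- Outcome 0 is the projection onto the complement; outcome t + 1 is the one onto the line of `e
  -- t`.
  refine ⟨⟨N + 1, fun _ => n, Fin.cons (1 - ∑ t, Q t) Q, ?_⟩, fun ν => ?_⟩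
  · rw [Fin.sum_univ_succ]
    simp only [Fin.cons_zero, Fin.cons_succ, hherm, hmul, if_true, Matrix.conjTranspose_sub,
      Matrix.conjTranspose_one, hsumh, sub_mul, mul_sub, Matrix.one_mul, Matrix.mul_one, hsum]
    abel
  · refine Fin.cases (Or.inr fun t => ?_) (fun t => Or.inl ⟨t, fun b hb => ?_⟩) ν
    · simp only [Fin.cons_zero, Matrix.sub_mulVec, Matrix.one_mulVec, Matrix.sum_mulVec, hvec]
      rw [Finset.sum_eq_single t, hcc, inv_mul_cancel₀ (hc0 t), one_smul, sub_self]
      · intro s _ hst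
        rw [horth s t hst, mul_zero, zero_smul]
      · simp
    · simp only [Fin.cons_succ, hvec, hb, mul_zero, zero_smul]

/-! ### Basis vectors, their sums and coordinate windows -/

theorem ket_eq_zero {d i : ℕ} (h : d ≤ i) : ket d i = 0 := by
  ext x
  simp only [ket, Pi.zero_apply, ite_eq_right_iff]
  intro hx
  omega

theorem ket_apply_of_eq {d i : ℕ} {x : Fin d} (h : (x : ℕ) = i) : ket d i x = 1 := if_pos h

theorem ket_apply_of_ne {d i : ℕ} {x : Fin d} (h : (x : ℕ) ≠ i) : ket d i x = 0 := if_neg h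

theorem ketSum_apply {d a b : ℕ} (x : Fin d) :
    ketSum d a b x = if a ≤ x ∧ (x : ℕ) ≤ b then 1 else 0 := by
  simp [ketSum, ket, Finset.sum_apply]

theorem star_ket (d i : ℕ) : star (ket d i) = ket d i := by
  ext x
  simp only [ket, Pi.star_apply]
  split_ifs <;> simp

theorem star_ketSum (d a b : ℕ) : star (ketSum d a b) = ketSum d a b := by
  simp [ketSum, star_sum, star_ket]

theorem ket_dotProduct {d i : ℕ} (h : i < d) (v : Fin d → ℂ) : ket d i ⬝ᵥ v = v ⟨i, h⟩ := by
  rw [dotProduct, Finset.sum_eq_single ⟨i, h⟩]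
  · simp [ket]
  · intro x _ hx
    rw [ket_apply_of_ne (fun h' => hx (Fin.ext h')), zero_mul]
  · simp

theorem ket_dotProduct_ket_of_eq {d i j : ℕ} (h : i = j) (hi : i < d) :
    ket d i ⬝ᵥ ket d j = 1 := by
  rw [ket_dotProduct hi, ket_apply_of_eq h]

theorem ket_dotProduct_ket_of_ne {d i j : ℕ} (h : i ≠ j) : ket d i ⬝ᵥ ket d j = 0 := by
  by_cases hi : i < d
  · rw [ket_dotProduct hi, ket_apply_of_ne h]
  · rw [ket_eq_zero (not_lt.mp hi), zero_dotProduct]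

theorem ket_dotProduct_ketSum_of_mem {d i a b : ℕ} (ha : a ≤ i) (hb : i ≤ b) (hi : i < d) :
    ket d i ⬝ᵥ ketSum d a b = 1 := by
  rw [ket_dotProduct hi, ketSum_apply, if_pos ⟨ha, hb⟩]

theorem ketSum_dotProduct_ket {d a b i : ℕ} :
    ketSum d a b ⬝ᵥ ket d i = ket d i ⬝ᵥ ketSum d a b := dotProduct_comm _ _

/-- The matrix that cuts the coordinates `s, …, s + r - 1` out of a vector of `ℂ^d`. -/
def window (d r s : ℕ) : Matrix (Fin r) (Fin d) ℂ :=
  Matrix.of fun i j => if (j : ℕ) = s + i then 1 else 0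

theorem window_mulVec_apply {d r s : ℕ} (h : s + r ≤ d) (a : Fin d → ℂ) (x : Fin r) :
    (window d r s).mulVec a x = a ⟨s + x, by omega⟩ :=
  ket_dotProduct (i := s + x) (by omega) a

theorem conjTranspose_window (d r s : ℕ) :
    (window d r s).conjTranspose = (window d r s).transpose := by
  ext x y
  simp only [Matrix.conjTranspose_apply, Matrix.transpose_apply, window, Matrix.of_apply]
  split_ifs <;> simp

theorem window_mul_conjTranspose {d r s : ℕ} (h : s + r ≤ d) :
    window d r s * (window d r s).conjTranspose = 1 := by
  rw [conjTranspose_window]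
  ext x y
  rw [Matrix.mul_apply]
  refine (ket_dotProduct (d := d) (i := s + x) (by omega) _).trans ?_
  simp only [window, Matrix.transpose_apply, Matrix.of_apply, Matrix.one_apply, Fin.ext_iff]
  congr 1
  simp

theorem conjTranspose_window_mulVec_ket {d r s i : ℕ} (hi : i < r) :
    (window d r s).conjTranspose.mulVec (ket r i) = ket d (s + i) := by
  rw [conjTranspose_window]
  ext x
  rw [Matrix.mulVec, dotProduct_comm, ket_dotProduct hi]
  rfl

theorem window_mulVec_ket_of_le {d r s i : ℕ} (h : s + r ≤ d) (hi : s ≤ i) :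
    (window d r s).mulVec (ket d i) = ket r (i - s) := by
  ext x
  rw [window_mulVec_apply h]
  simp only [ket]
  congr 1
  simp only [eq_iff_iff]
  omega

theorem window_mulVec_ket_of_lt {d r s i : ℕ} (h : s + r ≤ d) (hi : i < s) :
    (window d r s).mulVec (ket d i) = 0 := by
  ext x
  rw [window_mulVec_apply h, ket_apply_of_ne (by simp; omega), Pi.zero_apply]

theorem window_mulVec_ketSum_of_le {d r s b : ℕ} (h : s + r ≤ d) (hb : s + r ≤ b + 1) :
    (window d r s).mulVec (ketSum d 0 b) = ketSum r 0 (r - 1) := by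
  ext x
  rw [window_mulVec_apply h, ketSum_apply, ketSum_apply, if_pos (by simp; omega),
    if_pos (by omega)]

theorem conjTranspose_window_mulVec_ketSum {d r s : ℕ} (hr : 0 < r) :
    (window d r s).conjTranspose.mulVec (ketSum r 0 (r - 1)) = ketSum d s (s + r - 1) := by
  simp only [ketSum, Matrix.mulVec_sum]
  rw [Finset.sum_congr rfl fun i hi => conjTranspose_window_mulVec_ket
    (d := d) (s := s) (r := r) (i := i) (by simp at hi; omega)]
  rw [← Finset.sum_image (g := fun i => s + i) (f := fun i => ket d i) (by simp)]
  congr 1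
  ext i
  simp only [Finset.mem_image, Finset.mem_Icc]
  constructor
  · rintro ⟨j, hj, rfl⟩
    omega
  · intro hi
    exact ⟨i - s, by omega, by omega⟩

theorem conjTranspose_window_mul_self_apply (d r s : ℕ) (x y : Fin d) :
    ((window d r s).conjTranspose * window d r s) x y =
      if x = y ∧ s ≤ x ∧ (x : ℕ) < s + r then 1 else 0 := by
  rw [conjTranspose_window, Matrix.mul_apply]
  by_cases hx : s ≤ x ∧ (x : ℕ) < s + r
  · rw [Finset.sum_eq_single (⟨x - s, by omega⟩ : Fin r)]
    · simp only [window, Matrix.transpose_apply, Matrix.of_apply]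
      rw [if_pos (by omega), one_mul]
      congr 1
      simp only [eq_iff_iff, Fin.ext_iff]
      omega
    · intro i _ hi
      simp only [window, Matrix.transpose_apply, Matrix.of_apply]
      rw [if_neg (fun h => hi (Fin.ext (by simp only; omega))), zero_mul]
    · simp
  · rw [if_neg (fun h => hx h.2)]
    refine Finset.sum_eq_zero fun i _ => ?_
    simp only [window, Matrix.transpose_apply, Matrix.of_apply]
    rw [if_neg (by omega), zero_mul]

/-- The measurement that tells the first `k` levels of `ℂ^(2k+1)` from the other `k + 1`. -/
def windowMeasurement (k : ℕ) : Measurement (2 * k + 1) where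
  outcomes := 2
  -- Outcome 0 has the window of length k starting at 0, outcome 1 the one of length k + 1 starting
  -- at k.
  dim := fun μ => k + μ
  op := fun μ => window (2 * k + 1) (k + μ) (k * μ)
  complete := by
    ext x y
    simp only [Fin.sum_univ_two, Matrix.add_apply, conjTranspose_window_mul_self_apply,
      Fin.val_zero, Fin.val_one, Matrix.one_apply]
    by_cases hxy : x = y
    · by_cases hx : (x : ℕ) < k
      · rw [if_pos (by omega), if_neg (by omega), if_pos hxy, add_zero]
      · rw [if_neg (by omega), if_pos (by omega), if_pos hxy, zero_add]
    · rw [if_neg (fun h => hxy h.1), if_neg (fun h => hxy h.1), if_neg hxy, add_zero]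

/-! ### The stable set left in each window -/

/-- `|i⟩|0-i⟩`, `|0-x⟩|j⟩` where `x` precedes `j` cyclically in `1, …, n-1`, and the
state with all coordinates one. -/
inductive StablePair (n : ℕ) : (Fin n → ℂ) → (Fin n → ℂ) → Prop
  | square (i : ℕ) (h : 1 ≤ i ∧ i < n) : StablePair n (ket n i) (ket n 0 - ket n i)
  | edge (x j : ℕ) (h : j = 1 ∧ x = n - 1 ∨ 2 ≤ j ∧ j < n ∧ x = j - 1) :
      StablePair n (ket n 0 - ket n x) (ket n j)
  | stopper : StablePair n (ketSum n 0 (n - 1)) (ketSum n 0 (n - 1))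

theorem ket_dotProduct_mulVec {n i j : ℕ} (hi : i < n) (hj : j < n)
    (E : Matrix (Fin n) (Fin n) ℂ) :
    ket n i ⬝ᵥ E.mulVec (ket n j) = E ⟨i, hi⟩ ⟨j, hj⟩ := by
  rw [ket_dotProduct hi, Matrix.mulVec, dotProduct_comm, ket_dotProduct hj]

theorem eq_smul_one_of_ket {n : ℕ} (hn : 0 < n) (E : Matrix (Fin n) (Fin n) ℂ)
    (hoff : ∀ i j, i < n → j < n → i ≠ j → ket n i ⬝ᵥ E.mulVec (ket n j) = 0)
    (hdiag : ∀ i, 1 ≤ i → i < n →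
      ket n i ⬝ᵥ E.mulVec (ket n i) = ket n 0 ⬝ᵥ E.mulVec (ket n 0)) :
    ∃ c : ℂ, E = c • 1 := by
  refine ⟨E ⟨0, hn⟩ ⟨0, hn⟩, ?_⟩
  ext x y
  rw [Matrix.smul_apply, Matrix.one_apply]
  split_ifs with hxy
  · subst hxy
    rcases Nat.eq_zero_or_pos x with h0 | h0
    · have : x = ⟨0, hn⟩ := Fin.ext h0
      simp [this]
    · have := hdiag x h0 x.2
      rw [ket_dotProduct_mulVec x.2 x.2, ket_dotProduct_mulVec hn hn] at this
      simpa using this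
  · have := hoff x y x.2 y.2 (fun h => hxy (Fin.ext h))
    rw [ket_dotProduct_mulVec x.2 y.2] at this
    simpa using this

theorem ketSum_dotProduct_mulVec {n i : ℕ} (hi : i < n) (E : Matrix (Fin n) (Fin n) ℂ)
    (hoff : ∀ i j, i < n → j < n → i ≠ j → ket n i ⬝ᵥ E.mulVec (ket n j) = 0) :
    ketSum n 0 (n - 1) ⬝ᵥ E.mulVec (ket n i) = ket n i ⬝ᵥ E.mulVec (ket n i) := by
  rw [ketSum, sum_dotProduct, Finset.sum_eq_single i]
  · intro j hj hji
    simp at hj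
    exact hoff j i (by omega) hi hji
  · intro h
    simp at h
    omega

theorem exists_cyclic_pred {n j : ℕ} (hn : 3 ≤ n) (hj : 1 ≤ j) (hjn : j < n) :
    ∃ x, (j = 1 ∧ x = n - 1 ∨ 2 ≤ j ∧ j < n ∧ x = j - 1) ∧ 1 ≤ x ∧ x < n ∧ x ≠ j := by
  by_cases h : j = 1
  · exact ⟨n - 1, by omega⟩
  · exact ⟨j - 1, by omega⟩

/-- Two squares overlap on Bob's side in |0⟩, which kills the entries of `E` between nonzero levels.
The square j and the edge with second factor |j⟩ then kill those between j and 0, since the edge's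
other level x differs from j. Finally the stopper against the edges equates each diagonal entry with
that at 0. -/
theorem StablePair.alice {n : ℕ} (hn : 3 ≤ n) : AliceStable (StablePair n) := by
  intro E hE
  have hs : ∀ i j, 1 ≤ i → i < n → 1 ≤ j → j < n → i ≠ j →
      ket n i ⬝ᵥ E.mulVec (ket n j) = 0 := by
    intro i j hi hin hj hjn hij
    have := hE _ _ _ _ (.square i ⟨hi, hin⟩) (.square j ⟨hj, hjn⟩)
      (by rw [star_ket, ket_dotProduct_ket_of_ne hij])
      (by
        simp (disch := omega) only [star_sub, star_ket, sub_dotProduct, dotProduct_sub,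
          ket_dotProduct_ket_of_eq, ket_dotProduct_ket_of_ne]
        norm_num)
    rwa [star_ket] at this
  -- Every nonzero level is the cyclic predecessor of some j, so every diagonal entry is reached by
  -- an edge.
  have hpred : ∀ x, 1 ≤ x → x < n → ∃ j, (j = 1 ∧ x = n - 1 ∨ 2 ≤ j ∧ j < n ∧ x = j - 1) ∧
      1 ≤ j ∧ j < n := by
    intro x hx hxn
    by_cases h : x = n - 1
    · exact ⟨1, by omega⟩
    · exact ⟨x + 1, by omega⟩
  have h0 : ∀ j, 1 ≤ j → j < n → ket n j ⬝ᵥ E.mulVec (ket n 0) = 0 ∧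
      ket n 0 ⬝ᵥ E.mulVec (ket n j) = 0 := by
    intro j hj hjn
    obtain ⟨x, hx, hx1, hxn, hxj⟩ := exists_cyclic_pred hn hj hjn
    have h1 := hE _ _ _ _ (.square j ⟨hj, hjn⟩) (.edge x j hx)
      (by
        simp (disch := omega) only [star_ket, dotProduct_sub, ket_dotProduct_ket_of_ne]
        norm_num)
      (by
        simp (disch := omega) only [star_sub, star_ket, sub_dotProduct,
          ket_dotProduct_ket_of_eq, ket_dotProduct_ket_of_ne]
        norm_num)
    have h2 := hE _ _ _ _ (.edge x j hx) (.square j ⟨hj, hjn⟩)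
      (by
        simp (disch := omega) only [star_sub, star_ket, sub_dotProduct, ket_dotProduct_ket_of_ne]
        norm_num)
      (by
        simp (disch := omega) only [star_ket, dotProduct_sub,
          ket_dotProduct_ket_of_eq, ket_dotProduct_ket_of_ne]
        norm_num)
    rw [star_ket, Matrix.mulVec_sub, dotProduct_sub, hs j x hj hjn hx1 hxn hxj.symm, sub_zero] at h1
    rw [star_sub, star_ket, star_ket, sub_dotProduct, hs x j hx1 hxn hj hjn hxj, sub_zero] at h2
    exact ⟨h1, h2⟩
  have hoff : ∀ i j, i < n → j < n → i ≠ j → ket n i ⬝ᵥ E.mulVec (ket n j) = 0 := by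
    intro i j hi hj hij
    rcases Nat.eq_zero_or_pos i with rfl | hi0
    · exact (h0 j (by omega) hj).2
    · rcases Nat.eq_zero_or_pos j with rfl | hj0
      · exact (h0 i hi0 hi).1
      · exact hs i j hi0 hi hj0 hj hij
  refine eq_smul_one_of_ket (by omega) E hoff fun x hx hxn => ?_
  obtain ⟨j, hj, hj1, hjn⟩ := hpred x hx hxn
  have h1 := hE _ _ _ _ .stopper (.edge x j hj)
    (by
      simp (disch := omega) only [star_ketSum, dotProduct_sub, ketSum_dotProduct_ket,
        ket_dotProduct_ketSum_of_mem, sub_self])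
    (by
      simp (disch := omega) only [star_ketSum, ketSum_dotProduct_ket,
        ket_dotProduct_ketSum_of_mem]
      norm_num)
  rw [star_ketSum, Matrix.mulVec_sub, dotProduct_sub, ketSum_dotProduct_mulVec (by omega) E hoff,
    ketSum_dotProduct_mulVec hxn E hoff, sub_eq_zero] at h1
  exact h1.symm

/-- The roles are exchanged: the edges overlap on Alice's side in |0⟩, an edge is now compared with
the square at its level x rather than at j, and the stopper is tested against squares. -/
theorem StablePair.bob {n : ℕ} (hn : 3 ≤ n) : BobStable (StablePair n) := by
  intro E hE
  have hs : ∀ i j, 1 ≤ i → i < n → 1 ≤ j → j < n → i ≠ j →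
      ket n i ⬝ᵥ E.mulVec (ket n j) = 0 := by
    intro i j hi hin hj hjn hij
    obtain ⟨x, hx, hx1, hxn, hxi⟩ := exists_cyclic_pred hn hi hin
    obtain ⟨y, hy, hy1, hyn, hyj⟩ := exists_cyclic_pred hn hj hjn
    have := hE _ _ _ _ (.edge x i hx) (.edge y j hy)
      (by rw [star_ket, ket_dotProduct_ket_of_ne hij])
      (by
        simp (disch := omega) only [star_sub, star_ket, sub_dotProduct, dotProduct_sub,
          ket_dotProduct_ket_of_eq, ket_dotProduct_ket_of_ne]
        norm_num)
    rwa [star_ket] at this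
  have h0 : ∀ j, 1 ≤ j → j < n → ket n j ⬝ᵥ E.mulVec (ket n 0) = 0 ∧
      ket n 0 ⬝ᵥ E.mulVec (ket n j) = 0 := by
    intro j hj hjn
    obtain ⟨x, hx, hx1, hxn, hxj⟩ := exists_cyclic_pred hn hj hjn
    have h1 := hE _ _ _ _ (.edge x j hx) (.square x ⟨hx1, hxn⟩)
      (by
        simp (disch := omega) only [star_ket, dotProduct_sub, ket_dotProduct_ket_of_ne]
        norm_num)
      (by
        simp (disch := omega) only [star_sub, star_ket, sub_dotProduct,
          ket_dotProduct_ket_of_eq, ket_dotProduct_ket_of_ne]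
        norm_num)
    have h2 := hE _ _ _ _ (.square x ⟨hx1, hxn⟩) (.edge x j hx)
      (by
        simp (disch := omega) only [star_sub, star_ket, sub_dotProduct, ket_dotProduct_ket_of_ne]
        norm_num)
      (by
        simp (disch := omega) only [star_ket, dotProduct_sub,
          ket_dotProduct_ket_of_eq, ket_dotProduct_ket_of_ne]
        norm_num)
    rw [star_ket, Matrix.mulVec_sub, dotProduct_sub, hs j x hj hjn hx1 hxn hxj.symm, sub_zero] at h1
    rw [star_sub, star_ket, star_ket, sub_dotProduct, hs x j hx1 hxn hj hjn hxj, sub_zero] at h2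
    exact ⟨h1, h2⟩
  have hoff : ∀ i j, i < n → j < n → i ≠ j → ket n i ⬝ᵥ E.mulVec (ket n j) = 0 := by
    intro i j hi hj hij
    rcases Nat.eq_zero_or_pos i with rfl | hi0
    · exact (h0 j (by omega) hj).2
    · rcases Nat.eq_zero_or_pos j with rfl | hj0
      · exact (h0 i hi0 hi).1
      · exact hs i j hi0 hi hj0 hj hij
  refine eq_smul_one_of_ket (by omega) E hoff fun x hx hxn => ?_
  have h1 := hE _ _ _ _ .stopper (.square x ⟨hx, hxn⟩)
    (by
      simp (disch := omega) only [star_ketSum, dotProduct_sub, ketSum_dotProduct_ket,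
        ket_dotProduct_ketSum_of_mem, sub_self])
    (by
      simp (disch := omega) only [star_ketSum, ketSum_dotProduct_ket,
        ket_dotProduct_ketSum_of_mem]
      norm_num)
  rw [star_ketSum, Matrix.mulVec_sub, dotProduct_sub, ketSum_dotProduct_mulVec (by omega) E hoff,
    ketSum_dotProduct_mulVec hxn E hoff, sub_eq_zero] at h1
  exact h1.symm

theorem ne_zero_of_ket_dotProduct {d i : ℕ} {v : Fin d → ℂ} (h : ket d i ⬝ᵥ v ≠ 0) : v ≠ 0 := by
  rintro rfl
  simp at h

theorem StablePair.ne_zero {n : ℕ} (hn : 3 ≤ n) {a b : Fin n → ℂ} (h : StablePair n a b) :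
    a ≠ 0 ∧ b ≠ 0 := by
  rcases h with ⟨i, h⟩ | ⟨x, j, h⟩ | _
  · refine ⟨ne_zero_of_ket_dotProduct (i := i) ?_, ne_zero_of_ket_dotProduct (i := 0) ?_⟩ <;>
    · simp (disch := omega) only [dotProduct_sub, ket_dotProduct_ket_of_eq,
        ket_dotProduct_ket_of_ne]
      norm_num
  · refine ⟨ne_zero_of_ket_dotProduct (i := 0) ?_, ne_zero_of_ket_dotProduct (i := j) ?_⟩ <;>
    · simp (disch := omega) only [dotProduct_sub, ket_dotProduct_ket_of_eq,
        ket_dotProduct_ket_of_ne]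
      norm_num
  · refine ⟨ne_zero_of_ket_dotProduct (i := 0) ?_, ne_zero_of_ket_dotProduct (i := 0) ?_⟩ <;>
    · simp (disch := omega) only [ket_dotProduct_ketSum_of_mem]
      norm_num

theorem StablePair.exists_orthogonal {n : ℕ} (hn : 3 ≤ n) :
    ∃ a b a' b', StablePair n a b ∧ StablePair n a' b' ∧ star a ⬝ᵥ a' = 0 :=
  ⟨_, _, _, _, .square 1 (by omega), .square 2 (by omega), by
    rw [star_ket, ket_dotProduct_ket_of_ne (by omega)]⟩

/-! ### Factors of the states of the construction -/

/-- The factors of the states whose first factor is supported on `0, …, k - 1`. -/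
inductive UpperPair (k : ℕ) : (Fin (2 * k + 1) → ℂ) → (Fin (2 * k + 1) → ℂ) → Prop
  | square (i : ℕ) (h : 1 ≤ i ∧ i ≤ k - 1) :
      UpperPair k (ket _ i) (ket _ 0 - ket _ i + ket _ (2 * k - i) - ket _ (2 * k))
  | edge (x j : ℕ) (h : j = 1 ∧ x = k - 1 ∨ 2 ≤ j ∧ j ≤ k - 1 ∧ x = j - 1) :
      UpperPair k (ket _ 0 - ket _ x) (ket _ j - ket _ (2 * k - j))
  | stopper : UpperPair k (ketSum _ 0 (k - 1)) (ketSum _ 0 (2 * k))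

/-- The factors of the states whose first factor is supported on `k, …, 2k`. -/
inductive LowerPair (k : ℕ) : (Fin (2 * k + 1) → ℂ) → (Fin (2 * k + 1) → ℂ) → Prop
  | square (i p q : ℕ)
      (h : i = 1 ∧ p = k - 3 ∧ q = k - 2 ∨ 2 ≤ i ∧ i ≤ k ∧ p = k - i ∧ q = k - 1) :
      LowerPair k (ket _ (k + i)) (ket _ k - ket _ (k + i) + ket _ p - ket _ q)
  | edge (x j q : ℕ)
      (h : j = 1 ∧ x = k ∧ q = k - 2 ∨ j = 2 ∧ x = 1 ∧ q = k - 1 ∨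
        3 ≤ j ∧ j ≤ k ∧ x = j - 1 ∧ q = k - j) :
      LowerPair k (ket _ k - ket _ (k + x)) (ket _ (k + j) - ket _ q)
  | stopper : LowerPair k (ketSum _ k (2 * k)) (ketSum _ 0 (2 * k))

theorem psiStates_eq (k : ℕ) :
    psiStates (2 * k + 1) k = {χ | ∃ a b, UpperPair k a b ∧ χ = tensorVec a b} := by
  ext χ
  constructor
  · rintro (((⟨i, h1, h2, rfl⟩ | h) | ⟨j, h1, h2, rfl⟩) | h)
    · exact ⟨_, _, .square i ⟨h1, h2⟩, rfl⟩
    · exact ⟨_, _, .edge (k - 1) 1 (Or.inl ⟨rfl, rfl⟩), h⟩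
    · exact ⟨_, _, .edge (j - 1) j (Or.inr ⟨h1, h2, rfl⟩), rfl⟩
    · exact ⟨_, _, .stopper, h⟩
  · rintro ⟨a, b, ⟨i, h⟩ | ⟨x, j, ⟨rfl, rfl⟩ | ⟨h1, h2, rfl⟩⟩ | _, rfl⟩
    · exact Or.inl (Or.inl (Or.inl ⟨i, h.1, h.2, rfl⟩))
    · exact Or.inl (Or.inl (Or.inr rfl))
    · exact Or.inl (Or.inr ⟨j, h1, h2, rfl⟩)
    · exact Or.inr rfl

theorem phiStates_eq {k : ℕ} :
    phiStates (2 * k + 1) k = {χ | ∃ a b, LowerPair k a b ∧ χ = tensorVec a b} := by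
  ext χ
  constructor
  · rintro ((((h | ⟨i, h1, h2, rfl⟩) | (h | h)) | ⟨j, h1, h2, rfl⟩) | h)
    · exact ⟨_, _, .square 1 (k - 3) (k - 2) (Or.inl ⟨rfl, rfl, rfl⟩), h⟩
    · exact ⟨_, _, .square i (k - i) (k - 1) (Or.inr ⟨h1, h2, rfl, rfl⟩), rfl⟩
    · refine ⟨_, _, .edge k 1 (k - 2) (Or.inl ⟨rfl, rfl, rfl⟩), ?_⟩
      rw [← two_mul]
      exact h
    · exact ⟨_, _, .edge 1 2 (k - 1) (Or.inr (Or.inl ⟨rfl, rfl, rfl⟩)), h⟩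
    · refine ⟨_, _, .edge (j - 1) j (k - j) (Or.inr (Or.inr ⟨h1, h2, rfl, rfl⟩)), ?_⟩
      rw [Nat.add_sub_assoc (by omega)]
    · exact ⟨_, _, .stopper, h⟩
  · rintro ⟨a, b, ⟨i, p, q, ⟨rfl, rfl, rfl⟩ | ⟨h1, h2, rfl, rfl⟩⟩ |
      ⟨x, j, q, ⟨rfl, rfl, rfl⟩ | ⟨rfl, rfl, rfl⟩ | ⟨h1, h2, rfl, rfl⟩⟩ | _, rfl⟩
    · exact Or.inl (Or.inl (Or.inl (Or.inl rfl)))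
    · exact Or.inl (Or.inl (Or.inl (Or.inr ⟨i, h1, h2, rfl⟩)))
    · rw [← two_mul]
      exact Or.inl (Or.inl (Or.inr (Or.inl rfl)))
    · exact Or.inl (Or.inl (Or.inr (Or.inr rfl)))
    · refine Or.inl (Or.inr ⟨j, h1, h2, ?_⟩)
      rw [Nat.add_sub_assoc (by omega)]
    · exact Or.inr rfl

/-- The factors of the states of `hiddenNonlocalSet (2 * k + 1)`. -/
def StatePair (k : ℕ) (a b : Fin (2 * k + 1) → ℂ) : Prop := UpperPair k a b ∨ LowerPair k a b

theorem hiddenNonlocalSet_eq (k : ℕ) :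
    hiddenNonlocalSet (2 * k + 1) = {χ | ∃ a b, StatePair k a b ∧ χ = tensorVec a b} := by
  have hk : (2 * k + 1 - 1) / 2 = k := by omega
  rw [hiddenNonlocalSet, hk, psiStates_eq, phiStates_eq]
  ext χ
  simp only [StatePair, Set.mem_union, Set.mem_ofPred_eq, or_and_right, exists_or]

/-! ### Orthogonality and nonvanishing within each window -/

section WindowProducts

variable {d r s : ℕ}

theorem star_window_mulVec_ket (i : ℕ) :
    star ((window d r s).mulVec (ket d i)) = (window d r s).mulVec (ket d i) := by
  rw [Matrix.star_mulVec, star_ket, conjTranspose_window, Matrix.vecMul_transpose]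

theorem window_ket_dotProduct_of_mem {i j : ℕ} (h : s + r ≤ d) (hij : i = j) (hs : s ≤ i)
    (hr : i < s + r) :
    (window d r s).mulVec (ket d i) ⬝ᵥ (window d r s).mulVec (ket d j) = 1 := by
  rw [window_mulVec_ket_of_le h hs, window_mulVec_ket_of_le h (hij ▸ hs),
    ket_dotProduct_ket_of_eq (by omega) (by omega)]

theorem window_ket_dotProduct_of_ne {i j : ℕ} (h : s + r ≤ d) (hij : i ≠ j) :
    (window d r s).mulVec (ket d i) ⬝ᵥ (window d r s).mulVec (ket d j) = 0 := by
  by_cases hi : s ≤ i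
  · by_cases hj : s ≤ j
    · rw [window_mulVec_ket_of_le h hi, window_mulVec_ket_of_le h hj,
        ket_dotProduct_ket_of_ne (by omega)]
    · rw [window_mulVec_ket_of_lt h (not_le.mp hj), dotProduct_zero]
  · rw [window_mulVec_ket_of_lt h (not_le.mp hi), zero_dotProduct]

theorem window_ket_dotProduct_ketSum_of_mem {i b : ℕ} (h : s + r ≤ d) (hb : s + r ≤ b + 1)
    (hs : s ≤ i) (hr : i < s + r) :
    (window d r s).mulVec (ket d i) ⬝ᵥ (window d r s).mulVec (ketSum d 0 b) = 1 := by
  rw [window_mulVec_ket_of_le h hs, window_mulVec_ketSum_of_le h hb,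
    ket_dotProduct_ketSum_of_mem (by omega) (by omega) (by omega)]

theorem window_ket_dotProduct_ketSum_of_lt {i b : ℕ} (h : s + r ≤ d) (hs : i < s) :
    (window d r s).mulVec (ket d i) ⬝ᵥ (window d r s).mulVec (ketSum d 0 b) = 0 := by
  rw [window_mulVec_ket_of_lt h hs, zero_dotProduct]

theorem window_ket_dotProduct_ketSum_of_gt {i b : ℕ} (h : s + r ≤ d) (hr : s + r ≤ i) :
    (window d r s).mulVec (ket d i) ⬝ᵥ (window d r s).mulVec (ketSum d 0 b) = 0 := by
  rw [window_mulVec_ket_of_le h (by omega), ket_eq_zero (by omega), zero_dotProduct]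

theorem ne_zero_of_window_ket_dotProduct {i : ℕ} {v : Fin r → ℂ}
    (h : (window d r s).mulVec (ket d i) ⬝ᵥ v ≠ 0) : v ≠ 0 := by
  rintro rfl
  simp at h

end WindowProducts

theorem star_dotProduct_eq_zero_comm {ι : Type*} [Fintype ι] {u v : ι → ℂ} :
    star u ⬝ᵥ v = 0 ↔ star v ⬝ᵥ u = 0 := by
  rw [← star_eq_zero, Matrix.star_dotProduct, star_star, dotProduct_comm]

/-- Bob's factors of distinct edges have disjoint supports, as do those of a square i and an edge
with x = i; disjointness survives any window. A square is orthogonal to the stopper in each window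
because 0 − i and (2k − i) − 2k both have coefficient sum zero. The remaining pairs are orthogonal
on Alice's side. -/
theorem UpperPair.orthogonal {k r s : ℕ} (hk : 5 ≤ k) (hsr : s = 0 ∧ r = k ∨ s = k ∧ r = k + 1)
    {a b a' b' : Fin (2 * k + 1) → ℂ} (h : UpperPair k a b) (h' : UpperPair k a' b')
    (hne : tensorVec a b ≠ tensorVec a' b') :
    star a ⬝ᵥ a' = 0 ∨
      star ((window _ r s).mulVec b) ⬝ᵥ (window _ r s).mulVec b' = 0 := by
  have hSE : ∀ i x j, 1 ≤ i ∧ i ≤ k - 1 → j = 1 ∧ x = k - 1 ∨ 2 ≤ j ∧ j ≤ k - 1 ∧ x = j - 1 →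
      star (ket (2 * k + 1) i) ⬝ᵥ (ket (2 * k + 1) 0 - ket _ x) = 0 ∨
      star ((window _ r s).mulVec
        (ket (2 * k + 1) 0 - ket _ i + ket _ (2 * k - i) - ket _ (2 * k))) ⬝ᵥ
        (window (2 * k + 1) r s).mulVec (ket _ j - ket _ (2 * k - j)) = 0 := by
    intro i x j hi hj
    by_cases hix : i = x
    · right
      simp (disch := omega) only [Matrix.mulVec_sub, Matrix.mulVec_add, star_sub, star_add,
        star_window_mulVec_ket, sub_dotProduct, add_dotProduct, dotProduct_sub,
        window_ket_dotProduct_of_ne]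
      norm_num
    · left
      simp (disch := omega) only [star_ket, dotProduct_sub, ket_dotProduct_ket_of_ne]
      norm_num
  have hST : ∀ i, 1 ≤ i ∧ i ≤ k - 1 →
      star ((window _ r s).mulVec
        (ket (2 * k + 1) 0 - ket _ i + ket _ (2 * k - i) - ket _ (2 * k))) ⬝ᵥ
        (window (2 * k + 1) r s).mulVec (ketSum _ 0 (2 * k)) = 0 := by
    intro i hi
    simp only [Matrix.mulVec_sub, Matrix.mulVec_add, star_sub, star_add,
        star_window_mulVec_ket, sub_dotProduct, add_dotProduct]
    rcases hsr with ⟨rfl, rfl⟩ | ⟨rfl, rfl⟩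
    · simp (disch := omega) only [window_ket_dotProduct_ketSum_of_mem,
        window_ket_dotProduct_ketSum_of_gt]
      norm_num
    · simp (disch := omega) only [window_ket_dotProduct_ketSum_of_mem,
        window_ket_dotProduct_ketSum_of_lt]
      norm_num
  have hET : ∀ x j, j = 1 ∧ x = k - 1 ∨ 2 ≤ j ∧ j ≤ k - 1 ∧ x = j - 1 →
      star (ket (2 * k + 1) 0 - ket _ x) ⬝ᵥ ketSum _ 0 (k - 1) = 0 := by
    intro x j hj
    simp (disch := omega) only [star_sub, star_ket, sub_dotProduct, ket_dotProduct_ketSum_of_mem,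
      sub_self]
  rcases h with ⟨i, hi⟩ | ⟨x, j, hj⟩ | _ <;> rcases h' with ⟨i', hi'⟩ | ⟨x', j', hj'⟩ | _
  · left
    rw [star_ket, ket_dotProduct_ket_of_ne]
    rintro rfl
    exact hne rfl
  · exact hSE _ _ _ hi hj'
  · exact Or.inr (hST _ hi)
  · rw [star_dotProduct_eq_zero_comm, star_dotProduct_eq_zero_comm (u := (window _ r s).mulVec _)]
    exact hSE _ _ _ hi' hj
  · right
    have hjj : j ≠ j' := by
      rintro rfl
      obtain rfl : x = x' := by omega
      exact hne rfl
    simp (disch := omega) only [Matrix.mulVec_sub, star_sub, star_window_mulVec_ket,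
      sub_dotProduct, dotProduct_sub, window_ket_dotProduct_of_ne]
    norm_num
  · exact Or.inl (hET _ _ hj)
  · rw [star_dotProduct_eq_zero_comm, star_dotProduct_eq_zero_comm (u := (window _ r s).mulVec _)]
    exact Or.inr (hST _ hi')
  · rw [star_dotProduct_eq_zero_comm]
    exact Or.inl (hET _ _ hj')
  · exact absurd rfl hne

/-- The pattern is that of the upper family, but the exceptional low levels matter. For i = 1 the
regular square tail (k − 1) − (k − 1) would cancel, so k − 3 and k − 2 are used. The edge with x = 1
must avoid these, and the edge with x = k must avoid k − 1; hence the partners of j = 1 and j = 2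
are interchanged. -/
theorem LowerPair.orthogonal {k r s : ℕ} (hk : 5 ≤ k) (hsr : s = 0 ∧ r = k ∨ s = k ∧ r = k + 1)
    {a b a' b' : Fin (2 * k + 1) → ℂ} (h : LowerPair k a b) (h' : LowerPair k a' b')
    (hne : tensorVec a b ≠ tensorVec a' b') :
    star a ⬝ᵥ a' = 0 ∨
      star ((window _ r s).mulVec b) ⬝ᵥ (window _ r s).mulVec b' = 0 := by
  have hSE : ∀ i p q x j q',
      i = 1 ∧ p = k - 3 ∧ q = k - 2 ∨ 2 ≤ i ∧ i ≤ k ∧ p = k - i ∧ q = k - 1 →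
      j = 1 ∧ x = k ∧ q' = k - 2 ∨ j = 2 ∧ x = 1 ∧ q' = k - 1 ∨
        3 ≤ j ∧ j ≤ k ∧ x = j - 1 ∧ q' = k - j →
      star (ket (2 * k + 1) (k + i)) ⬝ᵥ (ket (2 * k + 1) k - ket _ (k + x)) = 0 ∨
      star ((window _ r s).mulVec
        (ket (2 * k + 1) k - ket _ (k + i) + ket _ p - ket _ q)) ⬝ᵥ
        (window (2 * k + 1) r s).mulVec (ket _ (k + j) - ket _ q') = 0 := by
    intro i p q x j q' hi hj
    by_cases hix : i = x
    · right
      simp (disch := omega) only [Matrix.mulVec_sub, Matrix.mulVec_add, star_sub, star_add,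
        star_window_mulVec_ket, sub_dotProduct, add_dotProduct, dotProduct_sub,
        window_ket_dotProduct_of_ne]
      norm_num
    · left
      simp (disch := omega) only [star_ket, dotProduct_sub, ket_dotProduct_ket_of_ne]
      norm_num
  have hST : ∀ i p q,
      i = 1 ∧ p = k - 3 ∧ q = k - 2 ∨ 2 ≤ i ∧ i ≤ k ∧ p = k - i ∧ q = k - 1 →
      star ((window _ r s).mulVec
        (ket (2 * k + 1) k - ket _ (k + i) + ket _ p - ket _ q)) ⬝ᵥ
        (window (2 * k + 1) r s).mulVec (ketSum _ 0 (2 * k)) = 0 := by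
    intro i p q hi
    simp only [Matrix.mulVec_sub, Matrix.mulVec_add, star_sub, star_add,
        star_window_mulVec_ket, sub_dotProduct, add_dotProduct]
    rcases hsr with ⟨rfl, rfl⟩ | ⟨rfl, rfl⟩
    · simp (disch := omega) only [window_ket_dotProduct_ketSum_of_mem,
        window_ket_dotProduct_ketSum_of_gt]
      norm_num
    · simp (disch := omega) only [window_ket_dotProduct_ketSum_of_mem,
        window_ket_dotProduct_ketSum_of_lt]
      norm_num
  have hET : ∀ x j q, j = 1 ∧ x = k ∧ q = k - 2 ∨ j = 2 ∧ x = 1 ∧ q = k - 1 ∨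
        3 ≤ j ∧ j ≤ k ∧ x = j - 1 ∧ q = k - j →
      star (ket (2 * k + 1) k - ket _ (k + x)) ⬝ᵥ ketSum _ k (2 * k) = 0 := by
    intro x j q hj
    simp (disch := omega) only [star_sub, star_ket, sub_dotProduct, ket_dotProduct_ketSum_of_mem,
      sub_self]
  rcases h with ⟨i, p, q, hi⟩ | ⟨x, j, q, hj⟩ | _ <;>
    rcases h' with ⟨i', p', q', hi'⟩ | ⟨x', j', q', hj'⟩ | _
  · left
    rw [star_ket, ket_dotProduct_ket_of_ne]
    intro hii
    obtain rfl : i = i' := by omega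
    obtain rfl : p = p' := by omega
    obtain rfl : q = q' := by omega
    exact hne rfl
  · exact hSE _ _ _ _ _ _ hi hj'
  · exact Or.inr (hST _ _ _ hi)
  · rw [star_dotProduct_eq_zero_comm, star_dotProduct_eq_zero_comm (u := (window _ r s).mulVec _)]
    exact hSE _ _ _ _ _ _ hi' hj
  · right
    have hjj : j ≠ j' := by
      rintro rfl
      obtain rfl : x = x' := by omega
      obtain rfl : q = q' := by omega
      exact hne rfl
    simp (disch := omega) only [Matrix.mulVec_sub, star_sub, star_window_mulVec_ket,
      sub_dotProduct, dotProduct_sub, window_ket_dotProduct_of_ne]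
    norm_num
  · exact Or.inl (hET _ _ _ hj)
  · rw [star_dotProduct_eq_zero_comm, star_dotProduct_eq_zero_comm (u := (window _ r s).mulVec _)]
    exact Or.inr (hST _ _ _ hi')
  · rw [star_dotProduct_eq_zero_comm]
    exact Or.inl (hET _ _ _ hj')
  · exact absurd rfl hne

theorem UpperPair.apply_eq_zero {k : ℕ} {a b : Fin (2 * k + 1) → ℂ} (h : UpperPair k a b)
    {x : Fin (2 * k + 1)} (hx : k ≤ x) (hk : 1 ≤ k) : a x = 0 := by
  rcases h with ⟨i, hi⟩ | ⟨y, j, hj⟩ | _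
  · exact ket_apply_of_ne (by omega)
  · rw [Pi.sub_apply, ket_apply_of_ne (by omega), ket_apply_of_ne (by omega), sub_zero]
  · rw [ketSum_apply, if_neg (by omega)]

theorem LowerPair.apply_eq_zero {k : ℕ} {a b : Fin (2 * k + 1) → ℂ} (h : LowerPair k a b)
    {x : Fin (2 * k + 1)} (hx : x < k) : a x = 0 := by
  rcases h with ⟨i, p, q, hi⟩ | ⟨y, j, q, hj⟩ | _
  · exact ket_apply_of_ne (by omega)
  · rw [Pi.sub_apply, ket_apply_of_ne (by omega), ket_apply_of_ne (by omega), sub_zero]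
  · rw [ketSum_apply, if_neg (by omega)]

theorem UpperPair.star_dotProduct_lowerPair {k : ℕ} (hk : 1 ≤ k)
    {a b a' b' : Fin (2 * k + 1) → ℂ} (h : UpperPair k a b) (h' : LowerPair k a' b') :
    star a ⬝ᵥ a' = 0 := by
  refine Finset.sum_eq_zero fun x _ => ?_
  by_cases hx : (x : ℕ) < k
  · rw [h'.apply_eq_zero hx, mul_zero]
  · rw [Pi.star_apply, h.apply_eq_zero (not_lt.mp hx) hk, star_zero, zero_mul]

theorem StatePair.orthogonal {k r s : ℕ} (hk : 5 ≤ k) (hsr : s = 0 ∧ r = k ∨ s = k ∧ r = k + 1)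
    {a b a' b' : Fin (2 * k + 1) → ℂ} (h : StatePair k a b) (h' : StatePair k a' b')
    (hne : tensorVec a b ≠ tensorVec a' b') :
    star a ⬝ᵥ a' = 0 ∨
      star ((window _ r s).mulVec b) ⬝ᵥ (window _ r s).mulVec b' = 0 := by
  rcases h with h | h <;> rcases h' with h' | h'
  · exact h.orthogonal hk hsr h' hne
  · exact Or.inl (h.star_dotProduct_lowerPair (by omega) h')
  · exact Or.inl (star_dotProduct_eq_zero_comm.1 (h'.star_dotProduct_lowerPair (by omega) h))
  · exact h.orthogonal hk hsr h' hne

theorem StatePair.left_ne_zero {k : ℕ} (hk : 5 ≤ k) {a b : Fin (2 * k + 1) → ℂ}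
    (h : StatePair k a b) : a ≠ 0 := by
  rcases h with (⟨i, hi⟩ | ⟨x, j, hj⟩ | _) | (⟨i, p, q, hi⟩ | ⟨x, j, q, hj⟩ | _)
  · apply ne_zero_of_ket_dotProduct (i := i)
    rw [ket_dotProduct_ket_of_eq rfl (by omega)]
    exact one_ne_zero
  · apply ne_zero_of_ket_dotProduct (i := 0)
    rw [dotProduct_sub, ket_dotProduct_ket_of_eq rfl (by omega),
      ket_dotProduct_ket_of_ne (by omega)]
    norm_num
  · apply ne_zero_of_ket_dotProduct (i := 0)
    rw [ket_dotProduct_ketSum_of_mem (by omega) (by omega) (by omega)]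
    exact one_ne_zero
  · apply ne_zero_of_ket_dotProduct (i := k + i)
    rw [ket_dotProduct_ket_of_eq rfl (by omega)]
    exact one_ne_zero
  · apply ne_zero_of_ket_dotProduct (i := k)
    rw [dotProduct_sub, ket_dotProduct_ket_of_eq rfl (by omega),
      ket_dotProduct_ket_of_ne (by omega)]
    norm_num
  · apply ne_zero_of_ket_dotProduct (i := k)
    rw [ket_dotProduct_ketSum_of_mem (by omega) (by omega) (by omega)]
    exact one_ne_zero

/-- Each of Bob's factors has a level with nonzero coefficient in either window; the proof exhibits
one per type of state. -/
theorem StatePair.window_mulVec_ne_zero {k r s : ℕ} (hk : 5 ≤ k)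
    (hsr : s = 0 ∧ r = k ∨ s = k ∧ r = k + 1) {a b : Fin (2 * k + 1) → ℂ}
    (h : StatePair k a b) : (window _ r s).mulVec b ≠ 0 := by
  have key : ∀ i, (window (2 * k + 1) r s).mulVec (ket _ i) ⬝ᵥ (window _ r s).mulVec b ≠ 0 →
      (window _ r s).mulVec b ≠ 0 := fun i => ne_zero_of_window_ket_dotProduct
  rcases hsr with ⟨rfl, rfl⟩ | ⟨rfl, rfl⟩
  · rcases h with (⟨i, hi⟩ | ⟨x, j, hj⟩ | _) | (⟨i, p, q, hi⟩ | ⟨x, j, q, hj⟩ | _)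
    on_goal 1 => apply key 0
    on_goal 2 => apply key j
    on_goal 3 => apply key 0
    on_goal 4 => apply key q
    on_goal 5 => apply key q
    on_goal 6 => apply key 0
    all_goals
      simp (disch := omega) only [Matrix.mulVec_sub, Matrix.mulVec_add, dotProduct_sub,
        dotProduct_add, window_ket_dotProduct_of_ne, window_ket_dotProduct_of_mem,
        window_ket_dotProduct_ketSum_of_mem]
      norm_num
  · rcases h with (⟨i, hi⟩ | ⟨x, j, hj⟩ | _) | (⟨i, p, q, hi⟩ | ⟨x, j, q, hj⟩ | _)
    -- The substitution has replaced `k` by `s`, so these are the levels 2k, 2k − j, k and k + j.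
    on_goal 1 => apply key (2 * s)
    on_goal 2 => apply key (2 * s - j)
    on_goal 3 => apply key s
    on_goal 4 => apply key s
    on_goal 5 => apply key (s + j)
    on_goal 6 => apply key s
    all_goals
      simp (disch := omega) only [Matrix.mulVec_sub, Matrix.mulVec_add, dotProduct_sub,
        dotProduct_add, window_ket_dotProduct_of_ne, window_ket_dotProduct_of_mem,
        window_ket_dotProduct_ketSum_of_mem]
      norm_num

/-! ### Bob's window measurement activates nonlocality -/

theorem windowMeasurement_op_one (k : ℕ) :
    (windowMeasurement k).op (1 : Fin 2) = window (2 * k + 1) (k + 1) k := by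
  change window (2 * k + 1) (k + 1) (k * 1) = _
  rw [mul_one]

theorem windowMeasurement_start_length {k : ℕ} (ν : Fin 2) :
    k * (ν : ℕ) = 0 ∧ k + (ν : ℕ) = k ∨ k * (ν : ℕ) = k ∧ k + (ν : ℕ) = k + 1 := by
  fin_cases ν <;> simp

theorem StatePair.orthogonal_windowMeasurement {k : ℕ} (hk : 5 ≤ k)
    (ν : Fin (windowMeasurement k).outcomes) {a b a' b' : Fin (2 * k + 1) → ℂ}
    (h : StatePair k a b) (h' : StatePair k a' b') (hne : tensorVec a b ≠ tensorVec a' b') :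
    (star a ⬝ᵥ a') * (star (((windowMeasurement k).op ν).mulVec b) ⬝ᵥ
      ((windowMeasurement k).op ν).mulVec b') = 0 :=
  mul_eq_zero.2 (h.orthogonal hk (windowMeasurement_start_length ν) h' hne)

theorem trivial_kronecker_mulVec_tensorVec {m n : ℕ} (B : Measurement n)
    (μ : Fin (Measurement.trivial m).outcomes) (ν : Fin B.outcomes)
    (a : Fin m → ℂ) (b : Fin n → ℂ) :
    ((Measurement.trivial m).op μ ⊗ₖ B.op ν).mulVec (tensorVec a b) =
      tensorVec a ((B.op ν).mulVec b) := by
  refine (kronecker_mulVec_tensorVec _ _ _ _).trans ?_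
  congr 1
  exact Matrix.one_mulVec a

/-- The inner product of Bob's factors is the sum of those in the two windows, so orthogonality
follows from the windowed statement. -/
theorem StatePair.tensorVec_orthogonal {k : ℕ} (hk : 5 ≤ k) {a b a' b' : Fin (2 * k + 1) → ℂ}
    (h : StatePair k a b) (h' : StatePair k a' b') (hne : tensorVec a b ≠ tensorVec a' b') :
    star (tensorVec a b) ⬝ᵥ tensorVec a' b' = 0 := by
  rw [star_tensorVec_dotProduct, ← sum_star_mulVec_dotProduct _ (windowMeasurement k).complete b b',
    Finset.mul_sum]
  exact Finset.sum_eq_zero fun ν _ => h.orthogonal_windowMeasurement hk ν h' hne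

theorem StatePair.right_ne_zero {k : ℕ} (hk : 5 ≤ k) {a b : Fin (2 * k + 1) → ℂ}
    (h : StatePair k a b) : b ≠ 0 := by
  rintro rfl
  exact h.window_mulVec_ne_zero hk (Or.inl ⟨rfl, rfl⟩) (Matrix.mulVec_zero _)

theorem isOrthogonalSet_hiddenNonlocalSet {k : ℕ} (hk : 5 ≤ k) :
    IsOrthogonalSet (hiddenNonlocalSet (2 * k + 1)) := by
  rw [hiddenNonlocalSet_eq]
  refine ⟨?_, ?_⟩
  · rintro _ ⟨a, b, h, rfl⟩
    exact tensorVec_ne_zero (h.left_ne_zero hk) (h.right_ne_zero hk)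
  · rintro _ ⟨a, b, h, rfl⟩ _ ⟨a', b', h', rfl⟩ hne
    exact h.tensorVec_orthogonal hk h' hne

/-- The tails (2k − i) − 2k and −(2k − j) lie at levels k and above, outside the low window. -/
theorem StablePair.exists_upperPair {k : ℕ} (hk : 5 ≤ k) {a b : Fin k → ℂ}
    (h : StablePair k a b) :
    ∃ b', UpperPair k ((window (2 * k + 1) k 0).conjTranspose.mulVec a) b' ∧
      (window (2 * k + 1) k 0).mulVec b' = b := by
  rcases h with ⟨i, hi⟩ | ⟨x, j, hj⟩ | _
  · rw [conjTranspose_window_mulVec_ket (by omega), zero_add]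
    refine ⟨_, .square i (by omega), ?_⟩
    simp only [Matrix.mulVec_sub, Matrix.mulVec_add]
    rw [window_mulVec_ket_of_le (by omega) (by omega), window_mulVec_ket_of_le (by omega) (by omega),
      window_mulVec_ket_of_le (by omega) (by omega), window_mulVec_ket_of_le (by omega) (by omega),
      ket_eq_zero (i := 2 * k - i - 0) (by omega), ket_eq_zero (i := 2 * k - 0) (by omega)]
    simp
  · rw [Matrix.mulVec_sub, conjTranspose_window_mulVec_ket (by omega),
      conjTranspose_window_mulVec_ket (by omega), zero_add, zero_add]
    refine ⟨_, .edge x j (by omega), ?_⟩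
    rw [Matrix.mulVec_sub, window_mulVec_ket_of_le (by omega) (by omega),
      window_mulVec_ket_of_le (by omega) (by omega), ket_eq_zero (i := 2 * k - j - 0) (by omega)]
    simp
  · rw [conjTranspose_window_mulVec_ketSum (by omega), zero_add]
    exact ⟨_, .stopper, window_mulVec_ketSum_of_le (by omega) (by omega)⟩

/-- Here the tails lie below k, so the high window drops them whatever they are; the case
distinctions only select the tail prescribed for each i or j. -/
theorem StablePair.exists_lowerPair {k : ℕ} (hk : 5 ≤ k) {a b : Fin (k + 1) → ℂ}
    (h : StablePair (k + 1) a b) :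
    ∃ b', LowerPair k ((window (2 * k + 1) (k + 1) k).conjTranspose.mulVec a) b' ∧
      (window (2 * k + 1) (k + 1) k).mulVec b' = b := by
  have key : ∀ x q, q < k → (window (2 * k + 1) (k + 1) k).mulVec (ket _ (k + x) - ket _ q) =
      ket _ x := by
    intro x q hq
    rw [Matrix.mulVec_sub, window_mulVec_ket_of_le (by omega) (by omega),
      window_mulVec_ket_of_lt (by omega) hq, sub_zero, Nat.add_sub_cancel_left]
  have hsq : ∀ i p q, p < k → q < k → (window (2 * k + 1) (k + 1) k).mulVec
      (ket _ k - ket _ (k + i) + ket _ p - ket _ q) = ket _ 0 - ket _ i := by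
    intro i p q hp hq
    simp only [Matrix.mulVec_sub, Matrix.mulVec_add]
    rw [window_mulVec_ket_of_le (by omega) le_rfl, window_mulVec_ket_of_le (by omega) (by omega),
      window_mulVec_ket_of_lt (by omega) hp, window_mulVec_ket_of_lt (by omega) hq,
      Nat.add_sub_cancel_left, Nat.sub_self]
    simp
  rcases h with ⟨i, hi⟩ | ⟨x, j, hj⟩ | _
  · rw [conjTranspose_window_mulVec_ket (by omega)]
    by_cases hi1 : i = 1
    · exact ⟨_, .square i (k - 3) (k - 2) (by omega), hsq _ _ _ (by omega) (by omega)⟩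
    · exact ⟨_, .square i (k - i) (k - 1) (by omega), hsq _ _ _ (by omega) (by omega)⟩
  · rw [Matrix.mulVec_sub, conjTranspose_window_mulVec_ket (by omega),
      conjTranspose_window_mulVec_ket (by omega), add_zero]
    by_cases hj1 : j = 1
    · exact ⟨_, .edge x j (k - 2) (by omega), key _ _ (by omega)⟩
    by_cases hj2 : j = 2
    · exact ⟨_, .edge x j (k - 1) (by omega), key _ _ (by omega)⟩
    · exact ⟨_, .edge x j (k - j) (by omega), key _ _ (by omega)⟩
  · rw [conjTranspose_window_mulVec_ketSum (by omega)]
    rw [show k + (k + 1) - 1 = 2 * k by omega]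
    exact ⟨_, .stopper, window_mulVec_ketSum_of_le (by omega) (by omega)⟩

/-- The equality `e` lets Bob's dimension appear as the output dimension of a measurement outcome,
which need not be written as `r`. -/
theorem not_isLocallyDistinguishable_of_window {d r s n : ℕ} (hr : 3 ≤ r) (hd : s + r ≤ d)
    {S : Set (BipartiteVec d n)} (e : n = r)
    (hS : ∀ a b, StablePair r a b →
      tensorVec ((window d r s).conjTranspose.mulVec a) (fun x => b (Fin.cast e x)) ∈ S) :
    ¬ IsLocallyDistinguishable S := by
  subst e
  refine not_isLocallyDistinguishable_of_stable (fun a b h => h.ne_zero hr)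
    (StablePair.exists_orthogonal hr) (StablePair.alice hr) (StablePair.bob hr)
    (window d n s).conjTranspose 1 ?_ (by simp) ?_
  · rw [Matrix.conjTranspose_conjTranspose, window_mul_conjTranspose hd]
  · intro a b hab
    rw [Matrix.one_mulVec]
    exact hS a b hab

theorem activatesNonlocality_windowMeasurement {k : ℕ} (hk : 5 ≤ k) :
    ActivatesNonlocality (Measurement.trivial (2 * k + 1)) (windowMeasurement k)
      (hiddenNonlocalSet (2 * k + 1)) := by
  have hpres : PreservesOrthogonality (Measurement.trivial (2 * k + 1)) (windowMeasurement k)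
      (hiddenNonlocalSet (2 * k + 1)) := by
    rw [hiddenNonlocalSet_eq]
    rintro μ ν _ ⟨a, b, h, rfl⟩ _ ⟨a', b', h', rfl⟩ hne
    rw [trivial_kronecker_mulVec_tensorVec, trivial_kronecker_mulVec_tensorVec]
    refine (star_tensorVec_dotProduct _ _ _ _).trans ?_
    exact h.orthogonal_windowMeasurement hk ν h' hne
  have hne0 : ∀ μ ν, ∀ ψ ∈ hiddenNonlocalSet (2 * k + 1),
      ((Measurement.trivial (2 * k + 1)).op μ ⊗ₖ (windowMeasurement k).op ν).mulVec ψ ≠ 0 := by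
    rw [hiddenNonlocalSet_eq]
    rintro μ ν _ ⟨a, b, h, rfl⟩
    rw [trivial_kronecker_mulVec_tensorVec]
    exact tensorVec_ne_zero (h.left_ne_zero hk)
      (h.window_mulVec_ne_zero hk (windowMeasurement_start_length ν))
  refine ⟨hpres, fun μ ν => ⟨?_, ?_⟩⟩
  · have hmem : ∀ a b, StatePair k a b → tensorVec a (((windowMeasurement k).op ν).mulVec b) ∈
        postMeasurementSet (Measurement.trivial (2 * k + 1)) (windowMeasurement k) μ ν
          (hiddenNonlocalSet (2 * k + 1)) := by
      intro a b h
      have hm : tensorVec a b ∈ hiddenNonlocalSet (2 * k + 1) := by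
        rw [hiddenNonlocalSet_eq]
        exact ⟨a, b, h, rfl⟩
      have h0 := hne0 μ ν _ hm
      rw [trivial_kronecker_mulVec_tensorVec] at h0
      exact ⟨h0, _, hm, trivial_kronecker_mulVec_tensorVec _ _ _ _ _⟩
    have h2 : ∀ ν' : Fin 2, ν' = 0 ∨ ν' = 1 := by decide
    rcases h2 ν with rfl | rfl
    · refine not_isLocallyDistinguishable_of_window (d := 2 * k + 1) (r := k) (s := 0) (by omega)
        (by omega) rfl fun a b hab => ?_
      obtain ⟨b', hb', rfl⟩ := hab.exists_upperPair hk
      exact hmem _ _ (Or.inl hb')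
    · refine not_isLocallyDistinguishable_of_window (d := 2 * k + 1) (r := k + 1) (s := k)
        (by omega) (by omega) rfl fun a b hab => ?_
      obtain ⟨b', hb', rfl⟩ := hab.exists_lowerPair hk
      have hm := hmem _ _ (Or.inr hb')
      rw [windowMeasurement_op_one] at hm
      exact hm
  · have himage : postMeasurementSet (Measurement.trivial (2 * k + 1)) (windowMeasurement k) μ ν
        (hiddenNonlocalSet (2 * k + 1)) = (fun ψ => ((Measurement.trivial (2 * k + 1)).op μ ⊗ₖ
          (windowMeasurement k).op ν).mulVec ψ) '' hiddenNonlocalSet (2 * k + 1) := by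
      ext χ
      constructor
      · rintro ⟨-, h⟩
        exact h
      · rintro ⟨ψ, hψ, rfl⟩
        exact ⟨hne0 μ ν ψ hψ, ψ, hψ, rfl⟩
    rw [himage]
    -- Distinct states have nonzero orthogonal images, so the images differ.
    refine Set.InjOn.encard_image fun ψ hψ φ hφ heq => ?_
    by_contra hne
    have h0 := hpres μ ν ψ hψ φ hφ hne
    rw [← show _ = _ from heq] at h0
    exact hne0 μ ν ψ hψ (eq_zero_of_star_dotProduct_self h0)

/-! ### Local distinguishability -/

/-- The second party's vectors that distinguish the states with first factor on `0, …, k - 1`. -/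
def upperFrame (k : ℕ) (t : Fin k) : Fin (2 * k + 1) → ℂ :=
  ket _ t - ket _ (2 * k - t)

/-- The level paired with `k + j` by the second party. -/
def lowerPartner (k j : ℕ) : ℕ := if j = 1 then k - 2 else if j = 2 then k - 1 else k - j

/-- The second party's vectors that distinguish the states with first factor on `k, …, 2k`. -/
def lowerFrame (k : ℕ) (t : Fin (k + 1)) : Fin (2 * k + 1) → ℂ :=
  if (t : ℕ) = 0 then ketSum _ 0 (2 * k) else ket _ (k + t) - ket _ (lowerPartner k t)

theorem lowerPartner_spec {k j : ℕ} :
    j = 1 ∧ lowerPartner k j = k - 2 ∨ j = 2 ∧ lowerPartner k j = k - 1 ∨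
      j ≠ 1 ∧ j ≠ 2 ∧ lowerPartner k j = k - j := by
  unfold lowerPartner
  split_ifs <;> omega

theorem star_upperFrame (k : ℕ) (t : Fin k) : star (upperFrame k t) = upperFrame k t := by
  simp only [upperFrame, star_sub, star_ket]

theorem star_lowerFrame (k : ℕ) (t : Fin (k + 1)) : star (lowerFrame k t) = lowerFrame k t := by
  unfold lowerFrame
  split_ifs
  · exact star_ketSum _ _ _
  · simp only [star_sub, star_ket]

theorem upperFrame_ne_zero {k : ℕ} (t : Fin k) : upperFrame k t ≠ 0 := by
  apply ne_zero_of_ket_dotProduct (i := t)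
  simp (disch := omega) only [upperFrame, dotProduct_sub, ket_dotProduct_ket_of_eq,
    ket_dotProduct_ket_of_ne]
  norm_num

theorem upperFrame_orthogonal {k : ℕ} (s t : Fin k) (h : s ≠ t) :
    star (upperFrame k s) ⬝ᵥ upperFrame k t = 0 := by
  have h' : (s : ℕ) ≠ t := fun h' => h (Fin.ext h')
  rw [star_upperFrame]
  simp (disch := omega) only [upperFrame, sub_dotProduct, dotProduct_sub,
    ket_dotProduct_ket_of_ne]
  norm_num

theorem lowerFrame_ne_zero {k : ℕ} (hk : 5 ≤ k) (t : Fin (k + 1)) : lowerFrame k t ≠ 0 := by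
  have hp := lowerPartner_spec (k := k) (j := t)
  apply ne_zero_of_ket_dotProduct (i := k + t)
  unfold lowerFrame
  split_ifs
  · rw [ket_dotProduct_ketSum_of_mem (by omega) (by omega) (by omega)]
    exact one_ne_zero
  · simp (disch := omega) only [dotProduct_sub, ket_dotProduct_ket_of_eq,
      ket_dotProduct_ket_of_ne]
    norm_num

theorem lowerFrame_orthogonal {k : ℕ} (hk : 5 ≤ k) (s t : Fin (k + 1)) (h : s ≠ t) :
    star (lowerFrame k s) ⬝ᵥ lowerFrame k t = 0 := by
  have h' : (s : ℕ) ≠ t := fun h' => h (Fin.ext h')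
  have hs := lowerPartner_spec (k := k) (j := s)
  have ht := lowerPartner_spec (k := k) (j := t)
  rw [star_lowerFrame]
  unfold lowerFrame
  split_ifs
  · omega
  · simp (disch := omega) only [dotProduct_sub, ketSum_dotProduct_ket,
      ket_dotProduct_ketSum_of_mem, sub_self]
  · simp (disch := omega) only [sub_dotProduct, ket_dotProduct_ketSum_of_mem, sub_self]
  · simp (disch := omega) only [sub_dotProduct, dotProduct_sub, ket_dotProduct_ket_of_ne]
    norm_num

/-- The frame vector t meets only the edge j = t, the square i = t and, for t = 0, every square; it
never meets the stopper. Squares are told apart by Alice's level. A square and an edge sharing both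
outcomes would need i = x and i = j, against x ≠ j. -/
theorem UpperPair.eq_of_overlap {k : ℕ} (hk : 5 ≤ k) (t : Fin k) (x : Fin (2 * k + 1))
    {a b a' b' : Fin (2 * k + 1) → ℂ} (h : UpperPair k a b) (h' : UpperPair k a' b')
    (ha : a x ≠ 0) (ha' : a' x ≠ 0) (hb : star (upperFrame k t) ⬝ᵥ b ≠ 0)
    (hb' : star (upperFrame k t) ⬝ᵥ b' ≠ 0) : tensorVec a b = tensorVec a' b' := by
  have hS : ∀ i, 1 ≤ i ∧ i ≤ k - 1 → ket (2 * k + 1) i x ≠ 0 → (x : ℕ) = i := by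
    intro i _ h0
    by_contra hx
    exact h0 (ket_apply_of_ne hx)
  have hSf : ∀ i, 1 ≤ i ∧ i ≤ k - 1 → star (upperFrame k t) ⬝ᵥ
      (ket (2 * k + 1) 0 - ket _ i + ket _ (2 * k - i) - ket _ (2 * k)) ≠ 0 →
      (t : ℕ) = 0 ∨ (t : ℕ) = i := by
    intro i hi h0
    by_contra! ht
    apply h0
    rw [star_upperFrame]
    simp (disch := omega) only [upperFrame, sub_dotProduct, dotProduct_sub, dotProduct_add,
      ket_dotProduct_ket_of_ne]
    norm_num
  have hE : ∀ y j, j = 1 ∧ y = k - 1 ∨ 2 ≤ j ∧ j ≤ k - 1 ∧ y = j - 1 →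
      (ket (2 * k + 1) 0 - ket (2 * k + 1) y) x ≠ 0 → (x : ℕ) = 0 ∨ (x : ℕ) = y := by
    intro y j _ h0
    by_contra! hx
    exact h0 (by rw [Pi.sub_apply, ket_apply_of_ne hx.1, ket_apply_of_ne hx.2, sub_zero])
  have hEf : ∀ y j, j = 1 ∧ y = k - 1 ∨ 2 ≤ j ∧ j ≤ k - 1 ∧ y = j - 1 →
      star (upperFrame k t) ⬝ᵥ (ket (2 * k + 1) j - ket _ (2 * k - j)) ≠ 0 → (t : ℕ) = j := by
    intro y j hj h0
    by_contra ht
    apply h0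
    rw [star_upperFrame]
    simp (disch := omega) only [upperFrame, sub_dotProduct, dotProduct_sub,
      ket_dotProduct_ket_of_ne]
    norm_num
  have hT : star (upperFrame k t) ⬝ᵥ ketSum (2 * k + 1) 0 (2 * k) = 0 := by
    rw [star_upperFrame]
    simp (disch := omega) only [upperFrame, sub_dotProduct, ket_dotProduct_ketSum_of_mem,
      sub_self]
  rcases h with ⟨i, hi⟩ | ⟨y, j, hj⟩ | _ <;> rcases h' with ⟨i', hi'⟩ | ⟨y', j', hj'⟩ | _
  · obtain rfl : i = i' := (hS i hi ha).symm.trans (hS i' hi' ha')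
    rfl
  · have h1 := hS i hi ha
    have h2 := hSf i hi hb
    have h3 := hE y' j' hj' ha'
    have h4 := hEf y' j' hj' hb'
    omega
  · exact absurd hT hb'
  · have h1 := hS i' hi' ha'
    have h2 := hSf i' hi' hb'
    have h3 := hE y j hj ha
    have h4 := hEf y j hj hb
    omega
  · have h1 := hEf y j hj hb
    have h2 := hEf y' j' hj' hb'
    obtain rfl : j = j' := by omega
    obtain rfl : y = y' := by omega
    rfl
  · exact absurd hT hb'
  · exact absurd hT hb
  · exact absurd hT hb
  · exact absurd hT hb

/-- The vector t = 0 meets only the stopper, and t ≥ 1 meets only the edge j = t and the squares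
listed in `hSf`. None of those squares has i = x for that edge, so Alice's level separates them; it
also separates squares from each other. -/
theorem LowerPair.eq_of_overlap {k : ℕ} (hk : 5 ≤ k) (t : Fin (k + 1)) (x : Fin (2 * k + 1))
    {a b a' b' : Fin (2 * k + 1) → ℂ} (h : LowerPair k a b) (h' : LowerPair k a' b')
    (ha : a x ≠ 0) (ha' : a' x ≠ 0) (hb : star (lowerFrame k t) ⬝ᵥ b ≠ 0)
    (hb' : star (lowerFrame k t) ⬝ᵥ b' ≠ 0) : tensorVec a b = tensorVec a' b' := by
  have hp := lowerPartner_spec (k := k) (j := t)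
  have hS : ∀ i, ket (2 * k + 1) (k + i) x ≠ 0 → (x : ℕ) = k + i := by
    intro i h0
    by_contra hx
    exact h0 (ket_apply_of_ne hx)
  have hSf : ∀ i p q, i = 1 ∧ p = k - 3 ∧ q = k - 2 ∨ 2 ≤ i ∧ i ≤ k ∧ p = k - i ∧ q = k - 1 →
      star (lowerFrame k t) ⬝ᵥ
      (ket (2 * k + 1) k - ket _ (k + i) + ket _ p - ket _ q) ≠ 0 →
      (t : ℕ) = 1 ∧ i = 2 ∨ (t : ℕ) = 2 ∧ 3 ≤ i ∨ (t : ℕ) = 3 ∧ i = 1 ∨ (t : ℕ) = i ∧ 3 ≤ i := by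
    intro i p q hi h0
    by_contra! ht
    apply h0
    rw [star_lowerFrame]
    unfold lowerFrame
    split_ifs
    · simp (disch := omega) only [dotProduct_sub, dotProduct_add, ketSum_dotProduct_ket,
        ket_dotProduct_ketSum_of_mem]
      norm_num
    · by_cases h12 : (t : ℕ) = i
      -- Only i = 1 and i = 2 remain. The frame vector meets the square twice, with opposite signs:
      -- at k + 1 and k − 2, respectively at k + 2 and k − 1.
      · by_cases hi1 : i = 1
        · simp (disch := omega) only [sub_dotProduct, dotProduct_sub, dotProduct_add,
            ket_dotProduct_ket_of_ne, ket_dotProduct_ket_of_eq]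
          norm_num
        · simp (disch := omega) only [sub_dotProduct, dotProduct_sub, dotProduct_add,
            ket_dotProduct_ket_of_ne, ket_dotProduct_ket_of_eq]
          norm_num
      · simp (disch := omega) only [sub_dotProduct, dotProduct_sub, dotProduct_add,
          ket_dotProduct_ket_of_ne]
        norm_num
  have hE : ∀ y, (ket (2 * k + 1) k - ket (2 * k + 1) (k + y)) x ≠ 0 → (x : ℕ) = k ∨ (x : ℕ) = k + y := by
    intro y h0
    by_contra! hx
    exact h0 (by rw [Pi.sub_apply, ket_apply_of_ne hx.1, ket_apply_of_ne hx.2, sub_zero])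
  have hEf : ∀ y j q, j = 1 ∧ y = k ∧ q = k - 2 ∨ j = 2 ∧ y = 1 ∧ q = k - 1 ∨
        3 ≤ j ∧ j ≤ k ∧ y = j - 1 ∧ q = k - j →
      star (lowerFrame k t) ⬝ᵥ (ket (2 * k + 1) (k + j) - ket _ q) ≠ 0 → (t : ℕ) = j := by
    intro y j q hj h0
    by_contra ht
    apply h0
    rw [star_lowerFrame]
    unfold lowerFrame
    split_ifs
    · simp (disch := omega) only [dotProduct_sub, ketSum_dotProduct_ket,
        ket_dotProduct_ketSum_of_mem, sub_self]
    · simp (disch := omega) only [sub_dotProduct, dotProduct_sub,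
        ket_dotProduct_ket_of_ne]
      norm_num
  have hT : star (lowerFrame k t) ⬝ᵥ ketSum (2 * k + 1) 0 (2 * k) ≠ 0 → (t : ℕ) = 0 := by
    intro h0
    by_contra ht
    apply h0
    rw [star_lowerFrame]
    unfold lowerFrame
    rw [if_neg ht]
    simp (disch := omega) only [sub_dotProduct, ket_dotProduct_ketSum_of_mem, sub_self]
  rcases h with ⟨i, p, q, hi⟩ | ⟨y, j, q, hj⟩ | _ <;>
    rcases h' with ⟨i', p', q', hi'⟩ | ⟨y', j', q', hj'⟩ | _
  · have h1 := hS i ha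
    have h2 := hS i' ha'
    obtain rfl : i = i' := by omega
    obtain rfl : p = p' := by omega
    obtain rfl : q = q' := by omega
    rfl
  · have h1 := hS i ha
    have h2 := hSf i p q hi hb
    have h3 := hE y' ha'
    have h4 := hEf y' j' q' hj' hb'
    omega
  · have h2 := hSf i p q hi hb
    have h3 := hT hb'
    omega
  · have h1 := hS i' ha'
    have h2 := hSf i' p' q' hi' hb'
    have h3 := hE y ha
    have h4 := hEf y j q hj hb
    omega
  · have h1 := hEf y j q hj hb
    have h2 := hEf y' j' q' hj' hb'
    obtain rfl : j = j' := by omega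
    obtain rfl : y = y' := by omega
    obtain rfl : q = q' := by omega
    rfl
  · have h1 := hEf y j q hj hb
    have h2 := hT hb'
    omega
  · have h2 := hSf i' p' q' hi' hb'
    have h3 := hT hb
    omega
  · have h1 := hEf y' j' q' hj' hb'
    have h2 := hT hb
    omega
  · rfl

/-- The frame spans all of Bob's factors but the stopper's: an edge's factor is a frame vector and a
square's is the difference of the vectors 0 and i. -/
theorem UpperPair.eq_of_mulVec_ne_zero {k n : ℕ} (hk : 5 ≤ k)
    {M : Matrix (Fin n) (Fin (2 * k + 1)) ℂ} (hM : ∀ t, M.mulVec (upperFrame k t) = 0)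
    {a b : Fin (2 * k + 1) → ℂ} (h : UpperPair k a b) (hb : M.mulVec b ≠ 0) :
    a = ketSum _ 0 (k - 1) ∧ b = ketSum _ 0 (2 * k) := by
  rcases h with ⟨i, hi⟩ | ⟨y, j, hj⟩ | _
  · refine absurd ?_ hb
    have e : ket (2 * k + 1) 0 - ket _ i + ket _ (2 * k - i) - ket _ (2 * k) =
        upperFrame k ⟨0, by omega⟩ - upperFrame k ⟨i, by omega⟩ := by
      simp only [upperFrame, Nat.sub_zero]
      abel
    rw [e, Matrix.mulVec_sub, hM, hM, sub_zero]
  · exact absurd (hM ⟨j, by omega⟩) hb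
  · exact ⟨rfl, rfl⟩

/-- Edges and stopper have frame vectors as second factors, so only squares survive the complement
outcome; Alice's level then decides among them. -/
theorem LowerPair.eq_of_mulVec_ne_zero {k n : ℕ} (hk : 5 ≤ k)
    {M : Matrix (Fin n) (Fin (2 * k + 1)) ℂ} (hM : ∀ t, M.mulVec (lowerFrame k t) = 0)
    {a b : Fin (2 * k + 1) → ℂ} (h : LowerPair k a b) (hb : M.mulVec b ≠ 0) :
    ∃ i p q, (i = 1 ∧ p = k - 3 ∧ q = k - 2 ∨ 2 ≤ i ∧ i ≤ k ∧ p = k - i ∧ q = k - 1) ∧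
      a = ket _ (k + i) ∧ b = ket _ k - ket _ (k + i) + ket _ p - ket _ q := by
  rcases h with ⟨i, p, q, hi⟩ | ⟨y, j, q, hj⟩ | _
  · exact ⟨i, p, q, hi, rfl, rfl⟩
  · refine absurd ?_ hb
    have h1 := hM ⟨j, by omega⟩
    have hp := lowerPartner_spec (k := k) (j := j)
    rw [lowerFrame, if_neg (by simp only; omega)] at h1
    rw [show q = lowerPartner k j by omega]
    exact h1
  · exact absurd (hM 0) hb

theorem isLocallyDistinguishable_hiddenNonlocalSet {k : ℕ} (hk : 5 ≤ k) :
    IsLocallyDistinguishable (hiddenNonlocalSet (2 * k + 1)) := by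
  obtain ⟨U, hU⟩ := exists_measurement_of_orthogonal (upperFrame k) upperFrame_ne_zero
    upperFrame_orthogonal
  obtain ⟨V, hV⟩ := exists_measurement_of_orthogonal (lowerFrame k) (lowerFrame_ne_zero hk)
    (lowerFrame_orthogonal hk)
  have h0 : ∀ {a b}, StatePair k a b → ∀ x : Fin k, a ⟨x, by omega⟩ ≠ 0 → UpperPair k a b := by
    intro a b h x hx
    exact h.resolve_right fun h => hx (h.apply_eq_zero x.2)
  have h1 : ∀ {a b}, StatePair k a b → ∀ x : Fin (k + 1), a ⟨k + x, by omega⟩ ≠ 0 →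
      LowerPair k a b := by
    intro a b h x hx
    exact h.resolve_left fun h => hx (h.apply_eq_zero (by simp) (by omega))
  rw [hiddenNonlocalSet_eq]
  refine isLocallyDistinguishable_of_measurements _ (windowMeasurement k) fun μ => ?_
  have h2 : ∀ μ' : Fin 2, μ' = 0 ∨ μ' = 1 := by decide
  rcases h2 μ with rfl | rfl
  · have hap : ∀ (a : Fin (2 * k + 1) → ℂ) (x : Fin k),
        ((windowMeasurement k).op (0 : Fin 2)).mulVec a x = a ⟨x, by omega⟩ := by
      intro a x
      refine (window_mulVec_apply (s := 0) (r := k) (by omega) a x).trans ?_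
      simp only [zero_add]
    refine ⟨U, fun ν x a b a' b' hab hab' hax hax' hb hb' => ?_⟩
    replace hax := (hap a x).symm.trans_ne hax
    replace hax' := (hap a' x).symm.trans_ne hax'
    replace hab := h0 hab x hax
    replace hab' := h0 hab' x hax'
    rcases hU ν with ⟨t, ht⟩ | hν
    · exact hab.eq_of_overlap hk t _ hab' hax hax' (fun h => hb (ht _ h)) (fun h => hb' (ht _ h))
    · obtain ⟨rfl, rfl⟩ := hab.eq_of_mulVec_ne_zero hk hν hb
      obtain ⟨rfl, rfl⟩ := hab'.eq_of_mulVec_ne_zero hk hν hb'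
      rfl
  · have hap : ∀ (a : Fin (2 * k + 1) → ℂ) (x : Fin (k + 1)),
        ((windowMeasurement k).op (1 : Fin 2)).mulVec a x = a ⟨k + x, by omega⟩ := by
      intro a x
      rw [windowMeasurement_op_one]
      exact window_mulVec_apply (by omega) a x
    refine ⟨V, fun ν x a b a' b' hab hab' hax hax' hb hb' => ?_⟩
    replace hax := (hap a x).symm.trans_ne hax
    replace hax' := (hap a' x).symm.trans_ne hax'
    replace hab := h1 hab x hax
    replace hab' := h1 hab' x hax'
    rcases hV ν with ⟨t, ht⟩ | hν
    · exact hab.eq_of_overlap hk t _ hab' hax hax' (fun h => hb (ht _ h)) (fun h => hb' (ht _ h))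
    · obtain ⟨i, p, q, hi, rfl, rfl⟩ := hab.eq_of_mulVec_ne_zero hk hν hb
      obtain ⟨i', p', q', hi', rfl, rfl⟩ := hab'.eq_of_mulVec_ne_zero hk hν hb'
      have e1 := not_imp_comm.1 ket_apply_of_ne hax
      have e2 := not_imp_comm.1 ket_apply_of_ne hax'
      obtain rfl : i = i' := by omega
      obtain rfl : p = p' := by omega
      obtain rfl : q = q' := by omega
      rfl

/-! ### Partial traces and local irredundancy -/

/-- The part of the transformed vector `U a` in which the discarded subsystems are in the
basis state `z`. -/
def Factorisation.slice {d : ℕ} (F : Factorisation d) (D : Finset (Fin F.parts))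
    (a : Fin d → ℂ) (z : F.Discarded D) : F.Kept D → ℂ :=
  fun x => F.U.mulVec a (F.merge D x z)

/-- The reduced operator of `|a⟩⟨a|` after discarding the subsystems `D` of one party. -/
def Factorisation.reduced {d : ℕ} (F : Factorisation d) (D : Finset (Fin F.parts))
    (a : Fin d → ℂ) : Matrix (F.Kept D) (F.Kept D) ℂ :=
  ∑ z : F.Discarded D, Matrix.vecMulVec (F.slice D a z) (star (F.slice D a z))

theorem reducedState_tensorVec {m n : ℕ} (F : Factorisation m) (G : Factorisation n)
    (DA : Finset (Fin F.parts)) (DB : Finset (Fin G.parts)) (a : Fin m → ℂ) (b : Fin n → ℂ) :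
    reducedState F G DA DB (tensorVec a b) = F.reduced DA a ⊗ₖ G.reduced DB b := by
  have hmul : ∀ x, (F.U ⊗ₖ G.U).mulVec (tensorVec a b) x = F.U.mulVec a x.1 * G.U.mulVec b x.2 := by
    intro x
    simp only [Matrix.mulVec, dotProduct, tensorVec, Matrix.kroneckerMap_apply,
      Fintype.sum_prod_type, Finset.sum_mul_sum]
    exact Finset.sum_congr rfl fun _ _ => Finset.sum_congr rfl fun _ _ => by ring
  ext x y
  simp only [reducedState, partialTrace, Matrix.vecMulVec_apply, Pi.star_apply, hmul,
    Matrix.kroneckerMap_apply, Factorisation.reduced, Matrix.sum_apply, Factorisation.slice,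
    Finset.sum_mul_sum, star_mul']
  exact Finset.sum_congr rfl fun _ _ => Finset.sum_congr rfl fun _ _ => by ring

/-- The Hilbert-Schmidt product of two reduced states of one party. -/
def Factorisation.overlap {d : ℕ} (F : Factorisation d) (D : Finset (Fin F.parts))
    (a a' : Fin d → ℂ) : ℂ :=
  ((F.reduced D a).conjTranspose * F.reduced D a').trace

theorem trace_reducedState_tensorVec {m n : ℕ} (F : Factorisation m) (G : Factorisation n)
    (DA : Finset (Fin F.parts)) (DB : Finset (Fin G.parts)) (a a' : Fin m → ℂ)
    (b b' : Fin n → ℂ) :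
    ((reducedState F G DA DB (tensorVec a b)).conjTranspose *
      reducedState F G DA DB (tensorVec a' b')).trace =
      F.overlap DA a a' * G.overlap DB b b' := by
  rw [reducedState_tensorVec, reducedState_tensorVec, Matrix.conjTranspose_kronecker,
    ← Matrix.mul_kronecker_mul, Matrix.trace_kronecker]
  rfl

/-- A reduced state is a sum of rank-one operators over slices, so the Hilbert-Schmidt product is a
sum of squared moduli. It can vanish only if all slices of one vector are orthogonal to all slices
of the other. -/
theorem Factorisation.overlap_eq {d : ℕ} (F : Factorisation d) (D : Finset (Fin F.parts))
    (a a' : Fin d → ℂ) :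
    F.overlap D a a' =
      ((∑ z, ∑ z', ‖star (F.slice D a z) ⬝ᵥ F.slice D a' z'‖ ^ 2 : ℝ) : ℂ) := by
  simp only [Factorisation.overlap, Factorisation.reduced, Matrix.conjTranspose_sum,
    Matrix.conjTranspose_vecMulVec, star_star, Finset.sum_mul_sum, Matrix.trace_sum,
    Matrix.vecMulVec_mul_vecMulVec, Matrix.trace_vecMulVec, Complex.ofReal_sum]
  refine Finset.sum_congr rfl fun z _ => Finset.sum_congr rfl fun z' _ => ?_
  rw [dotProduct_smul, smul_eq_mul, Complex.ofReal_pow, ← Complex.mul_conj']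
  congr 1
  rw [starRingEnd_apply, Matrix.star_dotProduct, star_star, dotProduct_comm]

theorem Factorisation.slice_dotProduct_eq_zero {d : ℕ} {F : Factorisation d}
    {D : Finset (Fin F.parts)} {a a' : Fin d → ℂ} (h : F.overlap D a a' = 0)
    (z z' : F.Discarded D) : star (F.slice D a z) ⬝ᵥ F.slice D a' z' = 0 := by
  rw [F.overlap_eq, Complex.ofReal_eq_zero,
    Finset.sum_eq_zero_iff_of_nonneg (fun _ _ => by positivity)] at h
  have h1 := h z (Finset.mem_univ z)
  rw [Finset.sum_eq_zero_iff_of_nonneg (fun _ _ => by positivity)] at h1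
  simpa using h1 z' (Finset.mem_univ z')

/-- Splitting a basis label into its discarded and kept parts. -/
def Factorisation.splitEquiv {d : ℕ} (F : Factorisation d) (D : Finset (Fin F.parts)) :
    ((i : Fin F.parts) → Fin (F.dim i)) ≃ F.Discarded D × F.Kept D :=
  Equiv.piEquivPiSubtypeProd (fun i => i ∈ D) _

theorem Factorisation.sum_slice_dotProduct {d : ℕ} (F : Factorisation d)
    (D : Finset (Fin F.parts)) (a a' : Fin d → ℂ) :
    ∑ z, star (F.slice D a z) ⬝ᵥ F.slice D a' z = star a ⬝ᵥ a' := by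
  have h : star (F.U.mulVec a) ⬝ᵥ F.U.mulVec a' = star a ⬝ᵥ a' := by
    rw [star_mulVec_dotProduct_mulVec, F.isometry, Matrix.one_mulVec]
  rw [← h, dotProduct, ← (F.splitEquiv D).symm.sum_comp, Fintype.sum_prod_type]
  rfl

/-- The inner product of the vectors is the sum of those of slices with equal discarded label, and
each term vanishes with the overlap. -/
theorem Factorisation.overlap_ne_zero {d : ℕ} (F : Factorisation d) (D : Finset (Fin F.parts))
    {a a' : Fin d → ℂ} (h : star a ⬝ᵥ a' ≠ 0) : F.overlap D a a' ≠ 0 := by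
  intro h0
  apply h
  rw [← F.sum_slice_dotProduct D]
  exact Finset.sum_eq_zero fun z _ => Factorisation.slice_dotProduct_eq_zero h0 z z

theorem Factorisation.card_eq {d : ℕ} (F : Factorisation d) :
    Fintype.card ((i : Fin F.parts) → Fin (F.dim i)) = d := by
  have h1 := congrArg Matrix.trace F.isometry
  have h2 := congrArg Matrix.trace F.coisometry
  rw [Matrix.trace_mul_comm, h2, Matrix.trace_one, Matrix.trace_one, Fintype.card_fin] at h1
  exact_mod_cast h1

theorem card_le_of_orthogonal {ι κ : Type*} [Fintype ι] [Fintype κ] (v : ι → κ → ℂ)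
    (hv : ∀ i, v i ≠ 0) (horth : ∀ i j, i ≠ j → star (v i) ⬝ᵥ v j = 0) :
    Fintype.card ι ≤ Fintype.card κ := by
  have hli : LinearIndependent ℂ v := by
    rw [Fintype.linearIndependent_iff]
    intro g hg i
    have h1 := congrArg (fun w => star (v i) ⬝ᵥ w) hg
    simp only [dotProduct_sum, dotProduct_smul, dotProduct_zero] at h1
    rw [Finset.sum_eq_single i (fun j _ hj => by rw [horth i j hj.symm, smul_zero])
      (by simp), smul_eq_mul] at h1
    exact (mul_eq_zero.1 h1).resolve_right fun h => hv i (eq_zero_of_star_dotProduct_self h)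
  simpa using hli.fintype_card_le_finrank

/-- The discarded dimension divides the odd number d and is at least 2, hence at least 3. -/
theorem Factorisation.three_mul_card_kept_le {d : ℕ} (F : Factorisation d)
    {D : Finset (Fin F.parts)} (hD : D.Nonempty) (hd : Odd d) :
    3 * Fintype.card (F.Kept D) ≤ d := by
  have hcard : Fintype.card (F.Discarded D) * Fintype.card (F.Kept D) = d := by
    rw [← Fintype.card_prod, ← Fintype.card_congr (F.splitEquiv D), F.card_eq]
  have hodd : Odd (Fintype.card (F.Discarded D)) := Nat.Odd.of_mul_left (hcard.symm ▸ hd)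
  obtain ⟨i, hi⟩ := hD
  have htwo : 2 ≤ Fintype.card (F.Discarded D) := by
    rw [Fintype.card_pi]
    refine le_trans ?_ (Finset.single_le_prod' (f := fun j : {i // i ∈ D} =>
      Fintype.card (Fin (F.dim j))) (fun j _ => ?_) (Finset.mem_univ ⟨i, hi⟩))
    · simpa using F.two_le_dim i
    · have := F.two_le_dim j
      simp only [Fintype.card_fin]
      omega
  have hthree : 3 ≤ Fintype.card (F.Discarded D) := by
    obtain ⟨l, hl⟩ := hodd
    omega
  calc 3 * Fintype.card (F.Kept D)
      ≤ Fintype.card (F.Discarded D) * Fintype.card (F.Kept D) := by gcongr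
    _ = d := hcard

/-- In odd dimension at most `d / 3` vectors stay orthogonal when a subsystem is discarded. -/
theorem Factorisation.three_mul_card_le {d N : ℕ} (F : Factorisation d)
    {D : Finset (Fin F.parts)} (hD : D.Nonempty) (hd : Odd d) (a : Fin N → Fin d → ℂ)
    (ha : ∀ i, a i ≠ 0) (horth : ∀ i j, i ≠ j → F.overlap D (a i) (a j) = 0) :
    3 * N ≤ d := by
  -- One nonzero slice of each vector gives an orthogonal family in the kept space, whose dimension
  -- bounds its size.
  have hz : ∀ i, ∃ z, F.slice D (a i) z ≠ 0 := by
    intro i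
    by_contra! h
    apply ha i
    apply eq_zero_of_star_dotProduct_self
    rw [← F.sum_slice_dotProduct D]
    exact Finset.sum_eq_zero fun z _ => by rw [h, dotProduct_zero]
  choose z hz using hz
  have h1 := card_le_of_orthogonal (fun i => F.slice D (a i) (z i)) hz
    fun i j hij => Factorisation.slice_dotProduct_eq_zero (horth i j hij) _ _
  have h2 := F.three_mul_card_kept_le hD hd
  rw [Fintype.card_fin] at h1
  omega

theorem not_isLocallyRedundant_hiddenNonlocalSet {k : ℕ} (hk : 5 ≤ k) :
    ¬ IsLocallyRedundant (hiddenNonlocalSet (2 * k + 1)) := by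
  rintro ⟨F, G, DA, DB, hne, h⟩
  have hodd : Odd (2 * k + 1) := ⟨k, rfl⟩
  have key : ∀ {a b a' b'}, LowerPair k a b → LowerPair k a' b' →
      tensorVec a b ≠ tensorVec a' b' → F.overlap DA a a' * G.overlap DB b b' = 0 := by
    intro a b a' b' h1 h2 h12
    rw [← trace_reducedState_tensorVec]
    rw [hiddenNonlocalSet_eq] at h
    exact h _ ⟨a, b, Or.inr h1, rfl⟩ _ ⟨a', b', Or.inr h2, rfl⟩ h12
  have hdist : ∀ {a b a' b' : Fin (2 * k + 1) → ℂ}, LowerPair k a b →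
      (star a ⬝ᵥ a' = 0 ∨ star b ⬝ᵥ b' = 0) → tensorVec a b ≠ tensorVec a' b' := by
    intro a b a' b' h1 h0 heq
    have h2 := star_tensorVec_dotProduct a a' b b'
    rw [mul_eq_zero.2 h0, ← heq] at h2
    exact tensorVec_ne_zero (StatePair.left_ne_zero hk (Or.inr h1))
      (StatePair.right_ne_zero hk (Or.inr h1)) (eq_zero_of_star_dotProduct_self h2)
  rcases hne with hA | hB
  -- The squares with i ≥ 2 have |k⟩ − |k − 1⟩ in common on Bob's side, so Bob's overlaps are
  -- nonzero and Alice's must vanish.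
  · have hpair : ∀ i : Fin (k - 1), LowerPair k (ket _ (k + (i + 2)))
        (ket _ k - ket _ (k + (i + 2)) + ket _ (k - (i + 2)) - ket _ (k - 1)) :=
      fun i => .square (i + 2) (k - (i + 2)) (k - 1) (by omega)
    have := F.three_mul_card_le hA hodd (fun i : Fin (k - 1) => ket _ (k + (i + 2)))
      (fun i => StatePair.left_ne_zero hk (Or.inr (hpair i))) (fun i j hij => by
        have hij' : (i : ℕ) ≠ j := fun h' => hij (Fin.ext h')
        refine (mul_eq_zero.1 (key (hpair i) (hpair j) (hdist (hpair i) (Or.inl ?_)))).resolve_right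
          (G.overlap_ne_zero DB ?_)
        · rw [star_ket, ket_dotProduct_ket_of_ne (by omega)]
        · have h0 : (i : ℕ) = 0 ∨ 0 < (i : ℕ) := by omega
          simp only [star_sub, star_add, star_ket, sub_dotProduct, add_dotProduct, dotProduct_sub,
            dotProduct_add]
          simp (disch := omega) only [ket_dotProduct_ket_of_ne, ket_dotProduct_ket_of_eq]
          norm_num)
    -- The bound 3(k − 1) ≤ 2k + 1 means k ≤ 4, which d ≥ 11 excludes.
    omega
  -- The edges with j ≥ 2 have |k⟩ in common on Alice's side, so now Bob's overlaps must vanish.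
  · have hpair : ∀ j : Fin (k - 1), LowerPair k (ket _ k - ket _ (k + (j + 1)))
        (ket _ (k + (j + 2)) - ket _ (lowerPartner k (j + 2))) := by
      intro j
      have hj := lowerPartner_spec (k := k) (j := j + 2)
      exact .edge (j + 1) (j + 2) _ (by omega)
    have := G.three_mul_card_le hB hodd
      (fun j : Fin (k - 1) => ket _ (k + (j + 2)) - ket _ (lowerPartner k (j + 2)))
      (fun j => StatePair.right_ne_zero hk (Or.inr (hpair j))) (fun i j hij => by
        have hij' : (i : ℕ) ≠ j := fun h' => hij (Fin.ext h')
        have hi := lowerPartner_spec (k := k) (j := i + 2)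
        have hj := lowerPartner_spec (k := k) (j := j + 2)
        refine (mul_eq_zero.1 (key (hpair i) (hpair j) (hdist (hpair i) (Or.inr ?_)))).resolve_left
          (F.overlap_ne_zero DA ?_)
        · simp only [star_sub, star_ket]
          simp (disch := omega) only [sub_dotProduct, dotProduct_sub, ket_dotProduct_ket_of_ne]
          norm_num
        · simp only [star_sub, star_ket]
          simp (disch := omega) only [sub_dotProduct, dotProduct_sub, ket_dotProduct_ket_of_ne,
            ket_dotProduct_ket_of_eq]
          norm_num)
    omega

/-! ### Assembly of the result -/

theorem isProductState_of_mem_hiddenNonlocalSet {k : ℕ} (hk : 5 ≤ k) :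
    ∀ ψ ∈ hiddenNonlocalSet (2 * k + 1), IsProductState ψ := by
  intro ψ hψ
  refine ⟨(isOrthogonalSet_hiddenNonlocalSet hk).1 ψ hψ, ?_⟩
  rw [hiddenNonlocalSet_eq] at hψ
  obtain ⟨a, b, -, h⟩ := hψ
  exact ⟨a, b, h⟩

theorem theorem2 (d : ℕ) (hodd : Odd d) (hd : 11 ≤ d) :
    IsOrthogonalSet (hiddenNonlocalSet d) ∧
    (∀ ψ ∈ hiddenNonlocalSet d, IsProductState ψ) ∧
    HasGenuineHiddenNonlocalityI (hiddenNonlocalSet d) ∧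
    ∃ B : Measurement d,
      ActivatesNonlocality (Measurement.trivial d) B (hiddenNonlocalSet d) := by
  obtain ⟨k, rfl⟩ := hodd
  have hk : 5 ≤ k := by omega
  have hact := activatesNonlocality_windowMeasurement hk
  exact ⟨isOrthogonalSet_hiddenNonlocalSet hk, isProductState_of_mem_hiddenNonlocalSet hk,
    ⟨isLocallyDistinguishable_hiddenNonlocalSet hk, not_isLocallyRedundant_hiddenNonlocalSet hk,
      _, _, hact⟩, _, hact⟩
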